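/- Let $d \ge 1$ and let $\mathcal M$ be a $d$-dimensional compact $C^\infty$ Riemannian manifold without boundary, isometrically (and smoothly) embedded in $\mathbb R^D$; points of $\mathcal M$ are identified with their images, $\|\cdot\|$ is the Euclidean norm of $\mathbb R^D$, and $dV$ is the Riemannian volume measure. Let $p \in C^\infty(\mathcal M)$ be a probability density with respect to $dV$ such that $0 < p_{\min} \le p(x) \le p_{\max} < \infty$ for all $x \in \mathcal M$. Let $y_1,\dots,y_N$ be i.i.d. samples with law $p\,dV$, let $k = k(N)$ be a positive integer for all large $N$, and put, for $x \in \mathcal M$, $$\hat R(x) = \inf\Big\{ r>0 : \sum_{j=1}^N \mathbf 1_{\{\|y_j-x\|<r\}} \ge k \Big\}, \qquad \hat\rho(x) = \hat R(x)\Big(\frac{1}{m_0}\frac kN\Big)^{-1/d}, \qquad \bar\rho(x) = p(x)^{-1/d},$$ where $m_0 = \int_{\mathbb R^d} \mathbf 1_{[0,1)}(|u|^2)\,du$ is the volume of the unit ball of $\mathbb R^d$. Then there is a constant $C>0$, determined by $p$ (and $\mathcal M \subset \mathbb R^D$), such that the following holds. If $k = o(N)$ and $k/\log N \to \infty$ as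 $N \to \infty$, then for every $s>0$ there is $N_0$ (independent of $x$) such that for all $N \ge N_0$ and every fixed $x \in \mathcal M$, with probability greater than $1-2N^{-s}$, $$\frac{|\hat\rho(x)-\bar\rho(x)|}{\bar\rho(x)} \le C\Big(\frac kN\Big)^{2/d} + \frac 3d\sqrt{\frac{s\log N}{k}} .$$ -/

import Mathlib

open MeasureTheory Filter Topology Manifold Bundle Asymptotics
open scoped ContDiff

noncomputable section

/-- Gram matrix `g_{ij}(u)` of the Riemannian metric `g` in the chart `e`, i.e. the inner products
of the coordinate vector fields `∂_i`, `∂_j` at the point `e⁻¹(u)`. -/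
def chartGram {d : ℕ} {M : Type*} [TopologicalSpace M]
    [ChartedSpace (EuclideanSpace ℝ (Fin d)) M] [IsManifold (𝓡 d) ∞ M]
    (g : ContMDiffRiemannianMetric (𝓡 d) ∞ (EuclideanSpace ℝ (Fin d))
      (fun x : M => TangentSpace (𝓡 d) x))
    (e : OpenPartialHomeomorph M (EuclideanSpace ℝ (Fin d)))
    (u : EuclideanSpace ℝ (Fin d)) : Matrix (Fin d) (Fin d) ℝ :=
  Matrix.of fun i j =>
    g.inner (e.symm u)
      (mfderiv (𝓡 d) (𝓡 d) e.symm u (EuclideanSpace.single i (1 : ℝ)))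
      (mfderiv (𝓡 d) (𝓡 d) e.symm u (EuclideanSpace.single j (1 : ℝ)))

/-- The volume element `√(det g_{ij}(u)) du` of the chart `e`, as a measure on the manifold that is
carried by the domain of the chart. -/
def chartVolume {d : ℕ} {M : Type*} [TopologicalSpace M]
    [ChartedSpace (EuclideanSpace ℝ (Fin d)) M] [IsManifold (𝓡 d) ∞ M] [MeasurableSpace M]
    (g : ContMDiffRiemannianMetric (𝓡 d) ∞ (EuclideanSpace ℝ (Fin d))
      (fun x : M => TangentSpace (𝓡 d) x))
    (e : OpenPartialHomeomorph M (EuclideanSpace ℝ (Fin d))) : Measure M :=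
  ((volume.restrict e.target).withDensity
    fun u => ENNReal.ofReal (Real.sqrt (chartGram g e u).det)).map e.symm

/-- The Riemannian volume measure `dV` of `g` (no orientation is needed): the least measure that
dominates the volume element of every chart of the atlas. By `riemannianVolume_restrict_source`
below it is the measure that is equal to `√(det g_{ij}) du` in every chart. -/
def riemannianVolume {d : ℕ} {M : Type*} [TopologicalSpace M]
    [ChartedSpace (EuclideanSpace ℝ (Fin d)) M] [IsManifold (𝓡 d) ∞ M] [MeasurableSpace M]
    (g : ContMDiffRiemannianMetric (𝓡 d) ∞ (EuclideanSpace ℝ (Fin d))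
      (fun x : M => TangentSpace (𝓡 d) x)) : Measure M :=
  ⨆ e ∈ atlas (EuclideanSpace ℝ (Fin d)) M, chartVolume g e

theorem chartVolume_apply {d : ℕ} {M : Type*} [TopologicalSpace M]
    [ChartedSpace (EuclideanSpace ℝ (Fin d)) M] [IsManifold (𝓡 d) ∞ M]
    [MeasurableSpace M] [BorelSpace M]
    (g : ContMDiffRiemannianMetric (𝓡 d) ∞ (EuclideanSpace ℝ (Fin d))
      (fun x : M => TangentSpace (𝓡 d) x))
    (e : OpenPartialHomeomorph M (EuclideanSpace ℝ (Fin d))) {A : Set M} (hA : MeasurableSet A) :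
    chartVolume g e A = ∫⁻ u in e.target ∩ e.symm ⁻¹' A,
      ENNReal.ofReal (Real.sqrt (chartGram g e u).det) := by
  have hm : AEMeasurable e.symm (volume.restrict e.target) :=
    e.continuousOn_symm.aemeasurable e.open_target.measurableSet
  have hN : NullMeasurableSet (e.symm ⁻¹' A) (volume.restrict e.target) :=
    hm.nullMeasurableSet_preimage hA
  have hac := withDensity_absolutelyContinuous (volume.restrict e.target)
    (fun u => ENNReal.ofReal (Real.sqrt (chartGram g e u).det))
  rw [chartVolume, Measure.map_apply_of_aemeasurable (hm.mono_ac hac) hA,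
    withDensity_apply₀ _ hN, Measure.restrict_restrict₀ hN, Set.inter_comm]

theorem chartGram_det_change {d : ℕ} {M : Type*} [TopologicalSpace M]
    [ChartedSpace (EuclideanSpace ℝ (Fin d)) M] [IsManifold (𝓡 d) ∞ M]
    (g : ContMDiffRiemannianMetric (𝓡 d) ∞ (EuclideanSpace ℝ (Fin d))
      (fun x : M => TangentSpace (𝓡 d) x))
    {e e' : OpenPartialHomeomorph M (EuclideanSpace ℝ (Fin d))}
    (he : e ∈ atlas (EuclideanSpace ℝ (Fin d)) M) (he' : e' ∈ atlas (EuclideanSpace ℝ (Fin d)) M)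
    {u : EuclideanSpace ℝ (Fin d)} (hu : u ∈ e.target) (hu' : e.symm u ∈ e'.source) :
    DifferentiableAt ℝ (e' ∘ e.symm) u ∧
    Real.sqrt (chartGram g e u).det =
      |(fderiv ℝ (e' ∘ e.symm) u).det| * Real.sqrt (chartGram g e' (e' (e.symm u))).det := by
  have he1 := IsManifold.subset_maximalAtlas (I := 𝓡 d) (n := ∞) he
  have he1' := IsManifold.subset_maximalAtlas (I := 𝓡 d) (n := ∞) he'
  have hinf : (∞ : WithTop ℕ∞) ≠ 0 := by simp
  have d1 : MDifferentiableAt (𝓡 d) (𝓡 d) e.symm u :=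
    ((contMDiffOn_symm_of_mem_maximalAtlas he1).contMDiffAt
      (e.open_target.mem_nhds hu)).mdifferentiableAt hinf
  have d2 : MDifferentiableAt (𝓡 d) (𝓡 d) e' (e.symm u) :=
    ((contMDiffOn_of_mem_maximalAtlas he1').contMDiffAt
      (e'.open_source.mem_nhds hu')).mdifferentiableAt hinf
  have d3 : MDifferentiableAt (𝓡 d) (𝓡 d) e'.symm (e' (e.symm u)) :=
    ((contMDiffOn_symm_of_mem_maximalAtlas he1').contMDiffAt
      (e'.open_target.mem_nhds (e'.map_source hu'))).mdifferentiableAt hinf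
  have dT : MDifferentiableAt (𝓡 d) (𝓡 d) (e' ∘ e.symm) u := d2.comp u d1
  refine ⟨dT.differentiableAt, ?_⟩
  have hev : e.symm =ᶠ[𝓝 u] e'.symm ∘ (e' ∘ e.symm) := by
    filter_upwards [(e.continuousAt_symm hu).preimage_mem_nhds (e'.open_source.mem_nhds hu')]
      with v hv
    exact (e'.left_inv hv).symm
  have hpt : e'.symm (e' (e.symm u)) = e.symm u := e'.left_inv hu'
  set b := (EuclideanSpace.basisFun (Fin d) ℝ).toBasis with hb
  have hbi : ∀ i, b i = EuclideanSpace.single i (1 : ℝ) := fun i => by simp [hb]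
  let L : EuclideanSpace ℝ (Fin d) →L[ℝ] EuclideanSpace ℝ (Fin d) :=
    mfderiv (𝓡 d) (𝓡 d) e'.symm (e' (e.symm u))
  let J : EuclideanSpace ℝ (Fin d) →L[ℝ] EuclideanSpace ℝ (Fin d) := fderiv ℝ (e' ∘ e.symm) u
  let B : M → EuclideanSpace ℝ (Fin d) →L[ℝ] EuclideanSpace ℝ (Fin d) →L[ℝ] ℝ :=
    fun y => g.inner y
  let Jm : Matrix (Fin d) (Fin d) ℝ := LinearMap.toMatrix b b (J : _ →ₗ[ℝ] _)
  have hchain : ∀ v : EuclideanSpace ℝ (Fin d),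
      (mfderiv (𝓡 d) (𝓡 d) e.symm u : EuclideanSpace ℝ (Fin d) →L[ℝ] EuclideanSpace ℝ (Fin d)) v
        = L (J v) := by
    intro v
    have h1 := hev.mfderiv_eq (I := 𝓡 d) (I' := 𝓡 d)
    have h2 := mfderiv_comp (I := 𝓡 d) (I' := 𝓡 d) (I'' := 𝓡 d) u
      (g := e'.symm) (f := e' ∘ e.symm) d3 dT
    have h3 : mfderiv (𝓡 d) (𝓡 d) (e' ∘ e.symm) u = fderiv ℝ (e' ∘ e.symm) u := mfderiv_eq_fderiv
    rw [h3] at h2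
    have h4 : (mfderiv (𝓡 d) (𝓡 d) e.symm u :
        EuclideanSpace ℝ (Fin d) →L[ℝ] EuclideanSpace ℝ (Fin d)) = L.comp J := h1.trans h2
    rw [h4]; rfl
  have hJ : ∀ i, J (EuclideanSpace.single i (1 : ℝ)) = ∑ a, Jm a i • b a := by
    intro i
    rw [← hbi]
    have := b.sum_repr (J (b i))
    rw [← this]
    simp [Jm, LinearMap.toMatrix_apply]
  have hG : chartGram g e u = Jm.transpose * chartGram g e' (e' (e.symm u)) * Jm := by
    ext i j
    have h1 : chartGram g e u i j = B (e.symm u) (L (J (EuclideanSpace.single i (1 : ℝ))))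
        (L (J (EuclideanSpace.single j (1 : ℝ)))) := by
      rw [← hchain, ← hchain]; rfl
    have h2 : ∀ a c, chartGram g e' (e' (e.symm u)) a c = B (e.symm u) (L (b a)) (L (b c)) := by
      intro a c
      have h3 : chartGram g e' (e' (e.symm u)) a c =
          B (e'.symm (e' (e.symm u))) (L (EuclideanSpace.single a (1 : ℝ)))
            (L (EuclideanSpace.single c (1 : ℝ))) := rfl
      rw [h3, hbi, hbi, hpt]
    rw [h1, hJ, hJ, Matrix.mul_apply]
    simp only [Matrix.mul_apply, h2, Matrix.transpose_apply, map_sum, map_smul,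
      sum_apply, smul_apply, smul_eq_mul, Finset.sum_mul,
      Finset.mul_sum]
    refine Finset.sum_congr rfl fun a _ => Finset.sum_congr rfl fun c _ => by ring
  have hdet : (fderiv ℝ (e' ∘ e.symm) u).det = Jm.det := by
    have := LinearMap.det_toMatrix b (J : _ →ₗ[ℝ] _)
    exact this.symm
  rw [hG, Matrix.det_mul, Matrix.det_mul, Matrix.det_transpose, hdet,
    show Jm.det * (chartGram g e' (e' (e.symm u))).det * Jm.det
      = Jm.det ^ 2 * (chartGram g e' (e' (e.symm u))).det by ring,
    Real.sqrt_mul (sq_nonneg _), Real.sqrt_sq_eq_abs]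

/-- Two charts give the same volume to a set that lies in both domains. -/
theorem chartVolume_eq {d : ℕ} {M : Type*} [TopologicalSpace M]
    [ChartedSpace (EuclideanSpace ℝ (Fin d)) M] [IsManifold (𝓡 d) ∞ M]
    [MeasurableSpace M] [BorelSpace M]
    (g : ContMDiffRiemannianMetric (𝓡 d) ∞ (EuclideanSpace ℝ (Fin d))
      (fun x : M => TangentSpace (𝓡 d) x))
    {e e' : OpenPartialHomeomorph M (EuclideanSpace ℝ (Fin d))}
    (he : e ∈ atlas (EuclideanSpace ℝ (Fin d)) M) (he' : e' ∈ atlas (EuclideanSpace ℝ (Fin d)) M)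
    {A : Set M} (hA : MeasurableSet A) (h : A ⊆ e.source) (h' : A ⊆ e'.source) :
    chartVolume g e A = chartVolume g e' A := by
  have himg : ∀ f : OpenPartialHomeomorph M (EuclideanSpace ℝ (Fin d)),
      MeasurableSet (f.target ∩ f.symm ⁻¹' A) := by
    intro f
    have h1 : Measurable (f.target.domRestrict f.symm) :=
      (continuousOn_iff_continuous_domRestrict.1 f.continuousOn_symm).measurable
    have h2 := (MeasurableEmbedding.subtype_coe f.open_target.measurableSet).measurableSet_image.2
      (h1 hA)
    convert h2 using 1
    ext v
    simp [Set.domRestrict, and_comm]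
  have hmem : ∀ u ∈ e.target ∩ e.symm ⁻¹' A, u ∈ e.target ∧ e.symm u ∈ e'.source :=
    fun u hu => ⟨hu.1, h' hu.2⟩
  have hT : e'.target ∩ e'.symm ⁻¹' A = (e' ∘ e.symm) '' (e.target ∩ e.symm ⁻¹' A) := by
    ext v
    constructor
    · rintro ⟨hv, hvA⟩
      exact ⟨e (e'.symm v), ⟨e.map_source (h hvA), by simpa [e.left_inv (h hvA)] using hvA⟩,
        by simp [e.left_inv (h hvA), e'.right_inv hv]⟩
    · rintro ⟨u, hu, rfl⟩
      refine ⟨e'.map_source (hmem u hu).2, ?_⟩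
      have := e'.left_inv (hmem u hu).2
      simpa [this] using hu.2
  have hinj : Set.InjOn (e' ∘ e.symm) (e.target ∩ e.symm ⁻¹' A) :=
    e'.injOn.comp (e.symm.injOn.mono (fun u hu => hu.1)) (fun u hu => (hmem u hu).2)
  rw [chartVolume_apply g e hA, chartVolume_apply g e' hA, hT,
    lintegral_image_eq_lintegral_abs_det_fderiv_mul volume (himg e)
      (fun u hu => ((chartGram_det_change g he he' (hmem u hu).1
        (hmem u hu).2).1.hasFDerivAt).hasFDerivWithinAt) hinj]
  refine setLIntegral_congr_fun (himg e) fun u hu => ?_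
  rw [(chartGram_det_change g he he' (hmem u hu).1 (hmem u hu).2).2,
    ENNReal.ofReal_mul (abs_nonneg _)]
  rfl

theorem riemannianVolume_restrict_source {d : ℕ} {M : Type*} [TopologicalSpace M]
    [ChartedSpace (EuclideanSpace ℝ (Fin d)) M] [IsManifold (𝓡 d) ∞ M]
    [MeasurableSpace M] [BorelSpace M]
    (g : ContMDiffRiemannianMetric (𝓡 d) ∞ (EuclideanSpace ℝ (Fin d))
      (fun x : M => TangentSpace (𝓡 d) x))
    {e : OpenPartialHomeomorph M (EuclideanSpace ℝ (Fin d))}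
    (he : e ∈ atlas (EuclideanSpace ℝ (Fin d)) M) :
    (riemannianVolume g).restrict e.source = chartVolume g e := by
  have hm := e.open_source.measurableSet
  have hcarried : ∀ f : OpenPartialHomeomorph M (EuclideanSpace ℝ (Fin d)),
      ∀ A, MeasurableSet A → chartVolume g f A = chartVolume g f (A ∩ f.source) := by
    intro f A hA
    rw [chartVolume_apply g f hA, chartVolume_apply g f (hA.inter f.open_source.measurableSet)]
    congr 2
    ext u
    simp only [Set.mem_inter_iff, Set.mem_preimage]
    exact ⟨fun hu => ⟨hu.1, hu.2, f.map_target hu.1⟩, fun hu => ⟨hu.1, hu.2.1⟩⟩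
  have hle : ∀ f ∈ atlas (EuclideanSpace ℝ (Fin d)) M, chartVolume g f ≤ riemannianVolume g :=
    fun f hf => le_iSup₂ (f := fun f (_ : f ∈ atlas (EuclideanSpace ℝ (Fin d)) M) =>
      chartVolume g f) f hf
  have hub : riemannianVolume g ≤
      chartVolume g e + (riemannianVolume g).restrict e.sourceᶜ := by
    refine iSup₂_le fun f hf => Measure.le_iff.2 fun A hA => ?_
    rw [Measure.add_apply, Measure.restrict_apply hA, ← measure_inter_add_sdiff A hm]
    refine add_le_add ?_ (hle f hf _)
    rw [hcarried f _ (hA.inter hm), chartVolume_eq g hf he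
      ((hA.inter hm).inter f.open_source.measurableSet) Set.inter_subset_right
      (fun y hy => hy.1.2)]
    exact measure_mono fun y hy => hy.1.1
  refine Measure.ext fun A hA => le_antisymm ?_ ?_
  · rw [Measure.restrict_apply hA]
    refine (hub _).trans ?_
    rw [Measure.add_apply, Measure.restrict_apply (hA.inter hm)]
    have : A ∩ e.source ∩ e.sourceᶜ = ∅ := by
      ext y; simp
    rw [this, measure_empty, add_zero]
    exact measure_mono Set.inter_subset_left
  · rw [Measure.restrict_apply hA, hcarried e A hA]
    exact hle e he _

/-- The functional `m₀[h] = ∫_{ℝ^d} h(|u|²) du`. -/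
def m0 (d : ℕ) (h : ℝ → ℝ) : ℝ :=
  ∫ u : EuclideanSpace ℝ (Fin d), h (‖u‖ ^ 2)

/-- The kernel `h = 1_{[0,1)}` of the k-nearest-neighbour estimator. -/
def knnKernel : ℝ → ℝ := Set.indicator (Set.Ico 0 1) (fun _ => 1)

/-- `R̂(x) = inf {r > 0 : ∑_j 1_{‖y_j - x‖ < r} ≥ k}`, for the sample `Y = (y_j)` in `M`, where
distances are Euclidean distances in the ambient space of the embedding `ι`. -/
def knnRadius {D N : ℕ} {M : Type*} (ι : M → EuclideanSpace ℝ (Fin D)) (k : ℕ) (Y : Fin N → M)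
    (x : M) : ℝ :=
  sInf {r : ℝ | 0 < r ∧ k ≤ ∑ j : Fin N, if ‖ι (Y j) - ι x‖ < r then 1 else 0}

/-- The estimated bandwidth `ρ̂(x) = R̂(x) ((1 / m₀[h]) (k / N)) ^ (-1/d)`. -/
def rhoHat (d : ℕ) {D N : ℕ} {M : Type*} (ι : M → EuclideanSpace ℝ (Fin D)) (k : ℕ)
    (Y : Fin N → M) (x : M) : ℝ :=
  knnRadius ι k Y x * (1 / m0 d knnKernel * ((k : ℝ) / (N : ℝ))) ^ (-1 / (d : ℝ))

/-- The population bandwidth `ρ̄ = p ^ (-1/d)`. -/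
def rhoBar (d : ℕ) {M : Type*} (p : M → ℝ) (x : M) : ℝ :=
  p x ^ (-1 / (d : ℝ))

/-- The law of one sample: the measure `p dV`. -/
def samplingMeasure {d : ℕ} {M : Type*} [TopologicalSpace M]
    [ChartedSpace (EuclideanSpace ℝ (Fin d)) M] [IsManifold (𝓡 d) ∞ M] [MeasurableSpace M]
    (g : ContMDiffRiemannianMetric (𝓡 d) ∞ (EuclideanSpace ℝ (Fin d))
      (fun x : M => TangentSpace (𝓡 d) x)) (p : M → ℝ) : Measure M :=
  (riemannianVolume g).withDensity fun y => ENNReal.ofReal (p y)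

end

/-! The mass of a small Euclidean ball about `x` is `p(x) m₀ r^d + O(r^(d+2))`, uniformly in `x`:
there is no term of order `r^(d+1)`. Let `R` be the ideal radius, `p(x) m₀ R^d = k/N`. Then `ρ̄ = R
b` and `ρ̂ = R̂ b` with the same factor `b`, so the relative error of `ρ̂` is that of `R̂` against
`R`. The balls of radius `R(1 ± E)` have mass about `(k/N)(1 ± dE)`, with relative bias `O(R²) =
O((k/N)^(2/d))`. The part `C (k/N)^(2/d)` of `E` absorbs the bias; the rest, `ε/d`, leaves a margin
`ε` against which Chernoff's bound controls the two counts. If the larger ball holds at least `k`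
points and the smaller one fewer, then `R̂` lies between the two radii.

The expansion (`IsTamePatch.exists_expansion`) uses as coordinate `z` the orthogonal projection of
`φ v - φ u` to the tangent space at `φ u`, where `φ` is the inverse of a chart. Normal components
enter inner products only through products of two of them, hence to second order. So the volume
density is the Jacobian of the projection up to `O(r²)`, and the ball is a round ball up to a shell
of relative thickness `O(r²)`. The density is affine in `z` up to `O(r²)`, and its linear part
integrates to zero by symmetry. Compactness of the manifold makes the constants uniform. -/

/-- The determinant of the Gram matrix of the images of the standard basis under `B`. -/
noncomputable def gramDet {d : ℕ} {F : Type*} [NormedAddCommGroup F] [InnerProductSpace ℝ F]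
    (B : EuclideanSpace ℝ (Fin d) →L[ℝ] F) : ℝ :=
  (Matrix.of fun i j : Fin d =>
    inner ℝ (B (EuclideanSpace.single i 1)) (B (EuclideanSpace.single j 1))).det

/-! ### Orthogonal projection to a tangent space, and Gram determinants -/

section LinearAlgebra

variable {d : ℕ} {F : Type*} [NormedAddCommGroup F] [InnerProductSpace ℝ F]

/-- `A` is the orthogonal projection to the range of `L`, read in an orthonormal basis. The defect
of the inner product is the inner product of the two normal components, and each of these is no
longer than the distance to any vector `L x`. The product on the right is what later turns
first-order bounds into second-order ones. -/
theorem exists_coisometry [FiniteDimensional ℝ F] (L : EuclideanSpace ℝ (Fin d) →L[ℝ] F)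
    (hL : Function.Injective L) :
    ∃ A : F →L[ℝ] EuclideanSpace ℝ (Fin d), (∀ w, ‖A w‖ ≤ ‖w‖) ∧
      ∀ w z x y, |inner ℝ w z - inner ℝ (A w) (A z)| ≤ ‖w - L x‖ * ‖z - L y‖ := by
  set S : Submodule ℝ F := LinearMap.range (L : EuclideanSpace ℝ (Fin d) →ₗ[ℝ] F) with hS
  have hfin : Module.finrank ℝ S = d := by
    rw [hS, LinearMap.finrank_range_of_inj (by exact hL)]
    simp
  let b := (stdOrthonormalBasis ℝ S).reindex (finCongr hfin)
  let A : F →L[ℝ] EuclideanSpace ℝ (Fin d) :=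
    (b.repr.toContinuousLinearEquiv : S →L[ℝ] EuclideanSpace ℝ (Fin d)) ∘L
      S.orthogonalProjectionOnto
  have hA : ∀ w, A w = b.repr (S.orthogonalProjectionOnto w) := fun w => rfl
  have hmin : ∀ w x, ‖(w : F) - (S.orthogonalProjectionOnto w : F)‖ ≤ ‖w - L x‖ := by
    intro w x
    have h1 : (w - L x) = (w - (S.orthogonalProjectionOnto w : F)) +
        ((S.orthogonalProjectionOnto w : F) - L x) := by abel
    have h2 : inner ℝ (w - (S.orthogonalProjectionOnto w : F))
        ((S.orthogonalProjectionOnto w : F) - L x) = 0 := by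
      rw [real_inner_comm]
      exact Submodule.sub_starProjection_mem_orthogonal w _
        (S.sub_mem (S.orthogonalProjectionOnto w).2 ⟨x, rfl⟩)
    have h3 := norm_add_sq_eq_norm_sq_add_norm_sq_of_inner_eq_zero _ _ h2
    rw [← h1] at h3
    nlinarith [norm_nonneg (w - L x), norm_nonneg (w - (S.orthogonalProjectionOnto w : F)),
      mul_self_nonneg ‖(S.orthogonalProjectionOnto w : F) - L x‖]
  refine ⟨A, fun w => ?_, fun w z x y => ?_⟩
  · rw [hA, LinearIsometryEquiv.norm_map]
    exact S.norm_orthogonalProjectionOnto_apply_le w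
  · have h1 : inner ℝ w z - inner ℝ (A w) (A z) =
        inner ℝ (w - (S.orthogonalProjectionOnto w : F)) (z - (S.orthogonalProjectionOnto z : F)) := by
      rw [hA, hA, LinearIsometryEquiv.inner_map_map, Submodule.coe_inner]
      have h2 : inner ℝ (w - (S.orthogonalProjectionOnto w : F))
          (S.orthogonalProjectionOnto z : F) = 0 := by
        rw [real_inner_comm]
        exact Submodule.sub_starProjection_mem_orthogonal w _ (S.orthogonalProjectionOnto z).2
      have h3 : inner ℝ (S.orthogonalProjectionOnto w : F)
          (z - (S.orthogonalProjectionOnto z : F)) = 0 :=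
        Submodule.sub_starProjection_mem_orthogonal z _ (S.orthogonalProjectionOnto w).2
      rw [inner_sub_right, h2, sub_zero, inner_sub_left]
      rw [inner_sub_right] at h3
      linarith
    rw [h1]
    exact (abs_real_inner_le_norm _ _).trans
      (mul_le_mul (hmin _ _) (hmin _ _) (norm_nonneg _) (norm_nonneg _))

theorem gramDet_endomorphism (C : EuclideanSpace ℝ (Fin d) →L[ℝ] EuclideanSpace ℝ (Fin d)) :
    gramDet C = C.det ^ 2 := by
  set b := (EuclideanSpace.basisFun (Fin d) ℝ).toBasis with hb
  set N := LinearMap.toMatrix b b (C : _ →ₗ[ℝ] _) with hN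
  have h1 : C.det = N.det := (LinearMap.det_toMatrix b (C : _ →ₗ[ℝ] _)).symm
  rw [h1, sq]
  nth_rewrite 1 [← Matrix.det_transpose N]
  rw [← Matrix.det_mul]
  unfold gramDet
  congr 1
  ext i j
  simp [Matrix.mul_apply, hN, LinearMap.toMatrix_apply, hb, PiLp.inner_apply, mul_comm]

theorem gramDet_pos (B : EuclideanSpace ℝ (Fin d) →L[ℝ] F) (hB : Function.Injective B) :
    0 < gramDet B := by
  have h : LinearIndependent ℝ (fun i : Fin d => B (EuclideanSpace.single i 1)) := by
    have h1 := (EuclideanSpace.basisFun (Fin d) ℝ).toBasis.linearIndependent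
    have h2 := h1.map' (B : EuclideanSpace ℝ (Fin d) →ₗ[ℝ] F) (LinearMap.ker_eq_bot.2 hB)
    have h3 : (fun i : Fin d => B (EuclideanSpace.single i 1)) =
        (B : EuclideanSpace ℝ (Fin d) →ₗ[ℝ] F) ∘ (EuclideanSpace.basisFun (Fin d) ℝ).toBasis := by
      funext i
      simp
    rw [h3]
    exact h2
  exact (Matrix.posDef_gram_of_linearIndependent (𝕜 := ℝ) h).det_pos

theorem continuous_gramDet : Continuous (gramDet : (EuclideanSpace ℝ (Fin d) →L[ℝ] F) → ℝ) := by
  unfold gramDet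
  refine Continuous.matrix_det ?_
  refine continuous_matrix fun i j => ?_
  simp only [Matrix.of_apply]
  fun_prop

/-- The determinant is a polynomial in the entries, so its derivative is bounded on the compact
convex ball of matrices with entries at most `R`. -/
theorem exists_lipschitz_det (d : ℕ) (R : ℝ) :
    ∃ K : ℝ, 0 ≤ K ∧ ∀ X Y : Matrix (Fin d) (Fin d) ℝ, ∀ δ : ℝ, 0 ≤ δ → (∀ i j, |X i j| ≤ R) →
      (∀ i j, |Y i j| ≤ R) → (∀ i j, |X i j - Y i j| ≤ δ) → |X.det - Y.det| ≤ K * δ := by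
  rcases lt_or_ge R 0 with hR | hR
  · rcases Nat.eq_zero_or_pos d with rfl | hd
    · exact ⟨0, le_rfl, fun X Y δ _ _ _ _ => by simp⟩
    · exact ⟨0, le_rfl, fun X Y δ _ hX _ _ =>
        absurd (hX ⟨0, hd⟩ ⟨0, hd⟩) (not_le.2 (hR.trans_le (abs_nonneg _)))⟩
  let D : (Fin d → Fin d → ℝ) → ℝ := fun X => (Matrix.of X).det
  have hD : ContDiff ℝ 1 D := by
    have : D = fun X => ∑ σ : Equiv.Perm (Fin d), (Equiv.Perm.sign σ : ℤ) • ∏ i, X (σ i) i := by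
      funext X
      simp [D, Matrix.det_apply, Units.smul_def]
    rw [this]
    fun_prop
  have hc := (isCompact_closedBall (0 : Fin d → Fin d → ℝ) R).exists_bound_of_continuousOn
    (hD.continuous_fderiv one_ne_zero).continuousOn
  obtain ⟨K, hK⟩ := hc
  have hK0 : 0 ≤ K := (norm_nonneg _).trans (hK 0 (by simpa using hR))
  have hball : ∀ X : Matrix (Fin d) (Fin d) ℝ, ∀ δ : ℝ, 0 ≤ δ → (∀ i j, |X i j| ≤ δ) →
      ‖(fun i j => X i j : Fin d → Fin d → ℝ)‖ ≤ δ := fun X δ hδ hX =>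
    (pi_norm_le_iff_of_nonneg hδ).2 fun i => (pi_norm_le_iff_of_nonneg hδ).2 fun j => hX i j
  refine ⟨K, hK0, fun X Y δ hδ hX hY hXY => ?_⟩
  have h1 := (convex_closedBall (0 : Fin d → Fin d → ℝ) R).norm_image_sub_le_of_norm_fderiv_le
    (𝕜 := ℝ) (f := D) (fun x _ => (hD.differentiable one_ne_zero) x) hK
    (x := fun i j => Y i j) (y := fun i j => X i j)
    (by simpa using hball Y R hR hY) (by simpa using hball X R hR hX)
  refine h1.trans (mul_le_mul_of_nonneg_left ?_ hK0)
  exact hball (X - Y) δ hδ (by simpa using hXY)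

end LinearAlgebra

/-! ### Tame patches in tangential coordinates -/

/-- Uniform first and second order bounds for a parametrized patch `φ` and a function `f` on a
convex open set `W` that is small compared with these bounds. -/
structure IsTamePatch {d : ℕ} {F : Type*} [NormedAddCommGroup F] [InnerProductSpace ℝ F]
    (φ : EuclideanSpace ℝ (Fin d) → F) (f : EuclideanSpace ℝ (Fin d) → ℝ)
    (W : Set (EuclideanSpace ℝ (Fin d))) (c K j : ℝ) : Prop where
  c_pos : 0 < c
  K_pos : 0 < K
  j_pos : 0 < j
  isOpen : IsOpen W
  convex : Convex ℝ W
  differentiableAt : ∀ v ∈ W, DifferentiableAt ℝ φ v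
  norm_fderiv_le : ∀ v ∈ W, ‖fderiv ℝ φ v‖ ≤ K
  norm_fderiv_sub_le : ∀ u ∈ W, ∀ v ∈ W, ‖fderiv ℝ φ v - fderiv ℝ φ u‖ ≤ K * ‖v - u‖
  le_norm_fderiv : ∀ v ∈ W, ∀ w, c * ‖w‖ ≤ ‖fderiv ℝ φ v w‖
  differentiableAt_fun : ∀ v ∈ W, DifferentiableAt ℝ f v
  abs_fun_le : ∀ v ∈ W, |f v| ≤ K
  norm_fderiv_fun_le : ∀ v ∈ W, ‖fderiv ℝ f v‖ ≤ K
  norm_fderiv_fun_sub_le : ∀ u ∈ W, ∀ v ∈ W, ‖fderiv ℝ f v - fderiv ℝ f u‖ ≤ K * ‖v - u‖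
  le_gramDet : ∀ v ∈ W, j ≤ Real.sqrt (gramDet (fderiv ℝ φ v))
  small : ∀ u ∈ W, ∀ v ∈ W, K * ‖v - u‖ ≤ c / 2

/-- The mean value inequality is applied on the part of `W` within distance `‖v - u‖` of `u`, where
the derivative varies by at most `K * ‖v - u‖`. -/
theorem Convex.norm_image_sub_sub_fderiv_le {E G : Type*} [NormedAddCommGroup E] [NormedSpace ℝ E]
    [NormedAddCommGroup G] [NormedSpace ℝ G] {f : E → G} {W : Set E} {K : ℝ} (hW : Convex ℝ W)
    (hK : 0 ≤ K) (hf : ∀ v ∈ W, DifferentiableAt ℝ f v)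
    (hlip : ∀ u ∈ W, ∀ v ∈ W, ‖fderiv ℝ f v - fderiv ℝ f u‖ ≤ K * ‖v - u‖)
    {u v : E} (hu : u ∈ W) (hv : v ∈ W) :
    ‖f v - f u - fderiv ℝ f u (v - u)‖ ≤ K * ‖v - u‖ ^ 2 := by
  have h := (hW.inter (convex_closedBall u ‖v - u‖)).norm_image_sub_le_of_norm_hasFDerivWithin_le'
    (𝕜 := ℝ) (f := f) (f' := fderiv ℝ f) (φ := fderiv ℝ f u) (C := K * ‖v - u‖) (x := u) (y := v)
    (fun x hx => (hf x hx.1).hasFDerivAt.hasFDerivWithinAt)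
    (fun x hx => (hlip u hu x hx.1).trans
      (mul_le_mul_of_nonneg_left (mem_closedBall_iff_norm.1 hx.2) hK))
    ⟨hu, by simp⟩ ⟨hv, by simp [dist_eq_norm]⟩
  rw [sq, ← mul_assoc]
  exact h

namespace IsTamePatch

variable {d : ℕ} {F : Type*} [NormedAddCommGroup F] [InnerProductSpace ℝ F]
  {φ : EuclideanSpace ℝ (Fin d) → F} {f : EuclideanSpace ℝ (Fin d) → ℝ}
  {W : Set (EuclideanSpace ℝ (Fin d))} {c K j : ℝ} {u v w : EuclideanSpace ℝ (Fin d)}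
  {A : F →L[ℝ] EuclideanSpace ℝ (Fin d)} {r : ℝ}

theorem norm_image_sub_sub_le (h : IsTamePatch φ f W c K j) (hu : u ∈ W) (hv : v ∈ W) :
    ‖φ v - φ u - fderiv ℝ φ u (v - u)‖ ≤ K * ‖v - u‖ ^ 2 :=
  h.convex.norm_image_sub_sub_fderiv_le h.K_pos.le h.differentiableAt h.norm_fderiv_sub_le hu hv

theorem hasFDerivAt_projection (h : IsTamePatch φ f W c K j) (hv : v ∈ W) :
    HasFDerivAt (fun v => A (φ v - φ u)) (A ∘L fderiv ℝ φ v) v :=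
  A.hasFDerivAt.comp v ((h.differentiableAt v hv).hasFDerivAt.sub_const (φ u))

/-- The condition `small` keeps the derivative of the projected patch within `c / 2` of its value at
`u`, half of the lower bound `c`. Injectivity and surjectivity of the projection both rest on this.
-/
theorem projection_approx (h : IsTamePatch φ f W c K j) (hA : ∀ w, ‖A w‖ ≤ ‖w‖) (hu : u ∈ W)
    (hv : v ∈ W) (hw : w ∈ W) :
    ‖A (φ v - φ u) - A (φ w - φ u) - (A ∘L fderiv ℝ φ u) (v - w)‖ ≤ c / 2 * ‖v - w‖ := by
  refine h.convex.norm_image_sub_le_of_norm_hasFDerivWithin_le' (𝕜 := ℝ)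
    (f := fun v => A (φ v - φ u)) (f' := fun v => A ∘L fderiv ℝ φ v)
    (fun x hx => (h.hasFDerivAt_projection hx).hasFDerivWithinAt) (fun x hx => ?_) hw hv
  refine ContinuousLinearMap.opNorm_le_bound _ (by linarith [h.c_pos]) fun y => ?_
  have h1 : (A ∘L fderiv ℝ φ x - A ∘L fderiv ℝ φ u) y = A ((fderiv ℝ φ x - fderiv ℝ φ u) y) := by
    simp
  rw [h1]
  refine (hA _).trans ((ContinuousLinearMap.le_opNorm _ _).trans ?_)
  exact mul_le_mul_of_nonneg_right ((h.norm_fderiv_sub_le u hu x hx).trans (h.small u hu x hx))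
    (norm_nonneg _)

section Coisometry

variable (h : IsTamePatch φ f W c K j) (hA : ∀ w, ‖A w‖ ≤ ‖w‖) (hu : u ∈ W)
  (hA' : ∀ w z x y, |inner ℝ w z - inner ℝ (A w) (A z)| ≤
    ‖w - fderiv ℝ φ u x‖ * ‖z - fderiv ℝ φ u y‖)

include h hu hA'

theorem le_norm_projection_fderiv (x : EuclideanSpace ℝ (Fin d)) :
    c * ‖x‖ ≤ ‖(A ∘L fderiv ℝ φ u) x‖ := by
  -- Tangent vectors have no normal component, so the right side vanishes and `A` preserves their
  -- norms.
  have h1 := hA' (fderiv ℝ φ u x) (fderiv ℝ φ u x) x x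
  simp only [sub_self, norm_zero, mul_zero, abs_nonpos_iff, real_inner_self_eq_norm_sq] at h1
  have h2 : ‖A (fderiv ℝ φ u x)‖ = ‖fderiv ℝ φ u x‖ := by
    rw [← sq_eq_sq₀ (norm_nonneg _) (norm_nonneg _)]
    linarith
  simpa [h2] using h.le_norm_fderiv u hu x

include hA

theorem le_norm_projection_sub (hv : v ∈ W) (hw : w ∈ W) :
    c / 2 * ‖v - w‖ ≤ ‖A (φ v - φ u) - A (φ w - φ u)‖ := by
  have h1 := h.projection_approx hA hu hv hw
  have h2 := h.le_norm_projection_fderiv hu hA' (v - w)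
  have h3 := norm_sub_norm_le ((A ∘L fderiv ℝ φ u) (v - w)) (A (φ v - φ u) - A (φ w - φ u))
  rw [norm_sub_rev _ (A (φ v - φ u) - A (φ w - φ u))] at h3
  nlinarith [norm_nonneg (v - w)]

theorem injOn_projection : Set.InjOn (fun v => A (φ v - φ u)) W := by
  intro v hv w hw hvw
  have h1 := h.le_norm_projection_sub hA hu hA' hv hw
  have h2 : A (φ v - φ u) = A (φ w - φ u) := hvw
  rw [h2, sub_self, norm_zero] at h1
  have h3 : ‖v - w‖ ≤ 0 := by
    by_contra! h3
    nlinarith [h.c_pos]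
  exact sub_eq_zero.1 (norm_le_zero_iff.1 h3)

theorem norm_sub_le_norm_projection (hv : v ∈ W) : ‖v - u‖ ≤ 2 / c * ‖A (φ v - φ u)‖ := by
  have h1 := h.le_norm_projection_sub hA hu hA' hv hu
  rw [sub_self (φ u), map_zero, sub_zero] at h1
  have := h.c_pos
  rw [div_mul_eq_mul_div, le_div_iff₀ this]
  linarith

/-- A quantitative inverse function theorem: the linear part has a right inverse of norm `c⁻¹` and
the nonlinear deviation is `c / 2`, so the image covers a ball of radius `(c - c / 2) * ε`. This is
why the inner ball in `exists_expansion` is filled. -/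
theorem surjOn_projection {ε : ℝ} (hε : 0 ≤ ε) (hεW : Metric.closedBall u ε ⊆ W) :
    Metric.closedBall 0 (c / 2 * ε) ⊆ (fun v => A (φ v - φ u)) '' Metric.closedBall u ε := by
  have hc := h.c_pos
  have hinj : Function.Injective (A ∘L fderiv ℝ φ u) := by
    refine (injective_iff_map_eq_zero _).2 fun x hx => ?_
    have h1 := h.le_norm_projection_fderiv hu hA' x
    rw [hx, norm_zero] at h1
    exact norm_le_zero_iff.1 (by by_contra! h3; nlinarith)
  have hsurj : Function.Surjective (A ∘L fderiv ℝ φ u) :=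
    LinearMap.surjective_of_injective
      (f := ((A ∘L fderiv ℝ φ u : _ →L[ℝ] _) : EuclideanSpace ℝ (Fin d) →ₗ[ℝ] _)) hinj
  let R : (A ∘L fderiv ℝ φ u).NonlinearRightInverse :=
    { toFun := Function.surjInv hsurj
      nnnorm := ⟨c⁻¹, by positivity⟩
      bound' := fun y => by
        have h1 := h.le_norm_projection_fderiv hu hA' (Function.surjInv hsurj y)
        rw [Function.surjInv_eq hsurj y] at h1
        change _ ≤ c⁻¹ * ‖y‖
        rw [inv_mul_eq_div, le_div_iff₀ hc]
        linarith
      right_inv' := fun y => Function.surjInv_eq hsurj y }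
  have happ : ApproximatesLinearOn (fun v => A (φ v - φ u)) (A ∘L fderiv ℝ φ u) W
      ⟨c / 2, by positivity⟩ := by
    exact fun x hx y hy => h.projection_approx hA hu hx hy
  have h1 := happ.surjOn_closedBall_of_nonlinearRightInverse R hε hεW
  have h2 : ((c⁻¹)⁻¹ - c / 2) * ε = c / 2 * ε := by rw [inv_inv]; ring
  change Set.SurjOn _ _ (Metric.closedBall (A (φ u - φ u)) (((c⁻¹)⁻¹ - c / 2) * ε)) at h1
  rw [h2, sub_self, map_zero] at h1
  exact h1

/-- By Pythagoras the excess is the square of the normal component, which is itself of second order.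
Hence an ambient ball of radius `r` differs from a tangential one by a relative `O(r²)` in the
radius. -/
theorem norm_image_sub_sq_le (hv : v ∈ W) :
    ‖φ v - φ u‖ ^ 2 ≤ ‖A (φ v - φ u)‖ ^ 2 + (K * (2 / c) ^ 2) ^ 2 * ‖A (φ v - φ u)‖ ^ 4 := by
  have h1 := (le_abs_self _).trans (hA' (φ v - φ u) (φ v - φ u) (v - u) (v - u))
  rw [real_inner_self_eq_norm_sq, real_inner_self_eq_norm_sq] at h1
  have h2 := h.norm_image_sub_sub_le hu hv
  have h3 := h.norm_sub_le_norm_projection hA hu hA' hv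
  have hK := h.K_pos
  have h4 : ‖φ v - φ u - fderiv ℝ φ u (v - u)‖ ≤ K * (2 / c * ‖A (φ v - φ u)‖) ^ 2 :=
    h2.trans (by gcongr)
  have h5 := mul_le_mul h4 h4 (norm_nonneg _) (by positivity)
  have h6 : K * (2 / c * ‖A (φ v - φ u)‖) ^ 2 * (K * (2 / c * ‖A (φ v - φ u)‖) ^ 2) =
      (K * (2 / c) ^ 2) ^ 2 * ‖A (φ v - φ u)‖ ^ 4 := by ring
  linarith

/-- `ℓ` is the derivative of `f` at `u` composed with the inverse of the derivative of the
projection. The error consists of the Taylor remainder of `f` and that of `φ` carried through `ℓ`.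
-/
theorem exists_linear_approx : ∃ ℓ : EuclideanSpace ℝ (Fin d) →L[ℝ] ℝ, (∀ z, |ℓ z| ≤ K / c * ‖z‖) ∧
    ∀ v ∈ W, |f v - (f u + ℓ (A (φ v - φ u)))| ≤ (K + K / c * K) * ‖v - u‖ ^ 2 := by
  have hc := h.c_pos
  have hK := h.K_pos
  have hinj : Function.Injective ((A ∘L fderiv ℝ φ u : _ →L[ℝ] _) :
      EuclideanSpace ℝ (Fin d) →ₗ[ℝ] EuclideanSpace ℝ (Fin d)) := by
    refine (injective_iff_map_eq_zero _).2 fun x hx => ?_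
    have h1 := h.le_norm_projection_fderiv hu hA' x
    have hx' : (A ∘L fderiv ℝ φ u) x = 0 := hx
    rw [hx', norm_zero] at h1
    exact norm_le_zero_iff.1 (by by_contra! h3; nlinarith)
  let e := LinearEquiv.ofInjectiveEndo _ hinj
  have he : ∀ x, e x = (A ∘L fderiv ℝ φ u) x := fun x => rfl
  let ℓ : EuclideanSpace ℝ (Fin d) →L[ℝ] ℝ :=
    fderiv ℝ f u ∘L LinearMap.toContinuousLinearMap (e.symm : _ →ₗ[ℝ] _)
  have hℓ : ∀ z, ℓ z = fderiv ℝ f u (e.symm z) := fun z => rfl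
  have hb : ∀ z, |ℓ z| ≤ K / c * ‖z‖ := by
    intro z
    have h1 := h.le_norm_projection_fderiv hu hA' (e.symm z)
    rw [← he, LinearEquiv.apply_symm_apply] at h1
    have h2 : ‖e.symm z‖ ≤ ‖z‖ / c := by rw [le_div_iff₀ hc]; linarith
    rw [hℓ, ← Real.norm_eq_abs, div_mul_eq_mul_div, mul_div_assoc]
    exact ((fderiv ℝ f u).le_opNorm _).trans
      (mul_le_mul (h.norm_fderiv_fun_le u hu) h2 (norm_nonneg _) hK.le)
  refine ⟨ℓ, hb, fun v hv => ?_⟩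
  have h1 := h.convex.norm_image_sub_sub_fderiv_le hK.le h.differentiableAt_fun
    h.norm_fderiv_fun_sub_le hu hv
  have h2 := h.norm_image_sub_sub_le hu hv
  have h3 : fderiv ℝ f u (v - u) = ℓ (A (fderiv ℝ φ u (v - u))) := by
    rw [hℓ]
    congr 1
    exact (e.symm_apply_apply (v - u)).symm
  have h4 : f v - (f u + ℓ (A (φ v - φ u))) = (f v - f u - fderiv ℝ f u (v - u)) -
      ℓ (A (φ v - φ u - fderiv ℝ φ u (v - u))) := by
    rw [map_sub A _ (fderiv ℝ φ u (v - u)), map_sub ℓ, h3]; ring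
  rw [h4]
  refine (abs_sub _ _).trans ?_
  rw [add_mul]
  refine add_le_add h1 ((hb _).trans ?_)
  rw [mul_assoc]
  exact mul_le_mul_of_nonneg_left ((hA _).trans h2) (by positivity)

end Coisometry

universe w

/-- The normal part of the derivative vanishes at `u`, so it is `O(‖v - u‖)` at `v`, and the Gram
matrices before and after projection differ by a product of two such terms. The constant is chosen
before the patch, for uniformity in the centre. -/
theorem exists_abs_sqrt_gramDet_sub_le (d : ℕ) (c K j : ℝ) :
    ∃ K' : ℝ, 0 ≤ K' ∧ ∀ (F : Type w) [NormedAddCommGroup F] [InnerProductSpace ℝ F]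
      (φ : EuclideanSpace ℝ (Fin d) → F) (f : EuclideanSpace ℝ (Fin d) → ℝ)
      (W : Set (EuclideanSpace ℝ (Fin d))), IsTamePatch φ f W c K j →
      ∀ u ∈ W, ∀ A : F →L[ℝ] EuclideanSpace ℝ (Fin d), (∀ w, ‖A w‖ ≤ ‖w‖) →
      (∀ w z x y, |inner ℝ w z - inner ℝ (A w) (A z)| ≤
        ‖w - fderiv ℝ φ u x‖ * ‖z - fderiv ℝ φ u y‖) →
      ∀ v ∈ W, |(A ∘L fderiv ℝ φ v).det| ≤ K' ∧
        abs (Real.sqrt (gramDet (fderiv ℝ φ v)) - |(A ∘L fderiv ℝ φ v).det|) ≤ K' * ‖v - u‖ ^ 2 := by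
  obtain ⟨D, hD0, hD⟩ := exists_lipschitz_det d (K ^ 2 + 1)
  -- The first part bounds the Jacobian, by comparing its Gram matrix with the identity. The second
  -- comes from `|a - b| * (a + b) = |a ^ 2 - b ^ 2|` with `a ≥ j`. The absolute value is there
  -- because `j > 0` is known only once a patch is given.
  refine ⟨(2 + D * (K ^ 2 + 1)) + D * K ^ 2 / |j|, by positivity,
    fun F _ _ φ f W h u hu A hA hA' v hv => ?_⟩
  have hj := h.j_pos
  have hK := h.K_pos
  rw [abs_of_pos hj]
  have hB : ∀ i, ‖fderiv ℝ φ v (EuclideanSpace.single i 1)‖ ≤ K := fun i =>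
    ((fderiv ℝ φ v).le_of_opNorm_le (h.norm_fderiv_le v hv) _).trans (by simp)
  have hAB : ∀ i, ‖(A ∘L fderiv ℝ φ v) (EuclideanSpace.single i 1)‖ ≤ K := fun i =>
    (hA _).trans (hB i)
  have hX : ∀ i k, |inner ℝ (fderiv ℝ φ v (EuclideanSpace.single i 1))
      (fderiv ℝ φ v (EuclideanSpace.single k 1))| ≤ K ^ 2 + 1 := fun i k =>
    ((abs_real_inner_le_norm _ _).trans
      (mul_le_mul (hB i) (hB k) (norm_nonneg _) hK.le)).trans (by nlinarith)
  have hY' : ∀ i k, |inner ℝ ((A ∘L fderiv ℝ φ v) (EuclideanSpace.single i 1))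
      ((A ∘L fderiv ℝ φ v) (EuclideanSpace.single k 1))| ≤ K ^ 2 := fun i k =>
    ((abs_real_inner_le_norm _ _).trans
      (mul_le_mul (hAB i) (hAB k) (norm_nonneg _) hK.le)).trans (by nlinarith)
  have hI : ∀ i k, |(1 : Matrix (Fin d) (Fin d) ℝ) i k| ≤ 1 := by
    intro i k
    rw [Matrix.one_apply]
    split_ifs <;> simp
  have hdet : gramDet (A ∘L fderiv ℝ φ v) = (A ∘L fderiv ℝ φ v).det ^ 2 := gramDet_endomorphism _
  have h1 : |gramDet (A ∘L fderiv ℝ φ v) - 1| ≤ D * (K ^ 2 + 1) := by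
    suffices h0 : |gramDet (A ∘L fderiv ℝ φ v) - (1 : Matrix (Fin d) (Fin d) ℝ).det| ≤
        D * (K ^ 2 + 1) by rwa [Matrix.det_one] at h0
    refine hD _ _ _ (by positivity) (fun i k => (hY' i k).trans (by linarith))
      (fun i k => (hI i k).trans (by nlinarith)) fun i k => ?_
    exact (abs_sub _ _).trans (add_le_add (hY' i k) (hI i k))
  have h2 : |gramDet (fderiv ℝ φ v) - gramDet (A ∘L fderiv ℝ φ v)| ≤
      D * (K ^ 2 * ‖v - u‖ ^ 2) := by
    refine hD _ _ _ (by positivity) hX (fun i k => (hY' i k).trans (by linarith)) fun i k => ?_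
    have h3 : ∀ i, ‖fderiv ℝ φ v (EuclideanSpace.single i 1) -
        fderiv ℝ φ u (EuclideanSpace.single i 1)‖ ≤ K * ‖v - u‖ := fun i => by
      rw [← sub_apply]
      exact (ContinuousLinearMap.le_of_opNorm_le _ (h.norm_fderiv_sub_le u hu v hv) _).trans
        (by simp)
    refine (hA' _ _ (EuclideanSpace.single i 1) (EuclideanSpace.single k 1)).trans ?_
    refine (mul_le_mul (h3 i) (h3 k) (norm_nonneg _) (by positivity)).trans (le_of_eq (by ring))
  set a := Real.sqrt (gramDet (fderiv ℝ φ v)) with ha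
  set b := |(A ∘L fderiv ℝ φ v).det| with hb
  have hb0 : 0 ≤ b := abs_nonneg _
  have hja : j ≤ a := h.le_gramDet v hv
  have ha2 : gramDet (fderiv ℝ φ v) = a ^ 2 := by
    rw [ha, Real.sq_sqrt]
    exact (Real.sqrt_pos.1 (hj.trans_le hja)).le
  rw [hdet, ← sq_abs, ← hb] at h1 h2
  rw [ha2] at h2
  constructor
  · have := (abs_le.1 h1).2
    have h5 : 0 ≤ D * K ^ 2 / j := by positivity
    nlinarith [sq_nonneg (b - 1)]
  · have h4 : |a - b| * j ≤ D * K ^ 2 * ‖v - u‖ ^ 2 := by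
      calc |a - b| * j ≤ |a - b| * |a + b| :=
            mul_le_mul_of_nonneg_left (by rw [abs_of_nonneg] <;> linarith) (abs_nonneg _)
        _ = |a ^ 2 - b ^ 2| := by rw [← abs_mul]; congr 1; ring
        _ ≤ _ := by linarith
    rw [← le_div_iff₀ hj] at h4
    refine h4.trans ?_
    rw [add_mul, mul_div_right_comm]
    have : 0 ≤ (2 + D * (K ^ 2 + 1)) * ‖v - u‖ ^ 2 := by positivity
    linarith

end IsTamePatch

/-! ### Mass of a small ambient ball in one patch -/

theorem EuclideanSpace.volume_real_ball (d : ℕ) (x : EuclideanSpace ℝ (Fin d)) {r : ℝ}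
    (hr : 0 < r) : volume.real (Metric.ball x r) =
      r ^ d * volume.real (Metric.ball (0 : EuclideanSpace ℝ (Fin d)) 1) := by
  rw [measureReal_def, Measure.addHaar_ball_of_pos volume x hr, ENNReal.toReal_mul,
    ENNReal.toReal_ofReal (by positivity), finrank_euclideanSpace_fin, measureReal_def]

theorem setIntegral_ball_clm_eq_zero {d : ℕ} (ℓ : EuclideanSpace ℝ (Fin d) →L[ℝ] ℝ) (r : ℝ) :
    ∫ h in Metric.ball (0 : EuclideanSpace ℝ (Fin d)) r, ℓ h = 0 := by
  have h1 := (Measure.measurePreserving_neg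
    (volume : Measure (EuclideanSpace ℝ (Fin d)))).setIntegral_preimage_emb
    (MeasurableEquiv.neg _).measurableEmbedding (fun h => ℓ h) (Metric.ball 0 r)
  have h2 : (Neg.neg : EuclideanSpace ℝ (Fin d) → _) ⁻¹' Metric.ball 0 r = Metric.ball 0 r := by
    ext x; simp
  rw [h2] at h1
  simp only [map_neg, integral_neg] at h1
  linarith

/-- An affine function integrates over a set that is squeezed between two concentric balls to its
value at the centre times the volume of the balls, up to the volume of the shell. -/
theorem abs_setIntegral_affine_sub_le {d : ℕ} {T : Set (EuclideanSpace ℝ (Fin d))} {r s a b : ℝ}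
    (ℓ : EuclideanSpace ℝ (Fin d) →L[ℝ] ℝ) (hT : MeasurableSet T) (hs : 0 < s) (hr : 0 < r)
    (hsT : Metric.ball 0 s ⊆ T) (hTr : T ⊆ Metric.ball 0 r) (hb : 0 ≤ b)
    (hℓ : ∀ z, |ℓ z| ≤ b * ‖z‖) :
    |(∫ z in T, (a + ℓ z)) - a * (r ^ d * volume.real (Metric.ball (0 : EuclideanSpace ℝ (Fin d)) 1))|
      ≤ (|a| + b * r) * ((r ^ d - s ^ d) *
        volume.real (Metric.ball (0 : EuclideanSpace ℝ (Fin d)) 1)) := by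
  set m := volume.real (Metric.ball (0 : EuclideanSpace ℝ (Fin d)) 1) with hm
  have hsr : Metric.ball (0 : EuclideanSpace ℝ (Fin d)) s ⊆ Metric.ball 0 r := hsT.trans hTr
  have hintℓ : IntegrableOn (fun z => ℓ z) (Metric.ball 0 r) :=
    (ℓ.continuous.continuousOn.integrableOn_compact (isCompact_closedBall 0 r)).mono_set
      Metric.ball_subset_closedBall
  have hinta : IntegrableOn (fun _ : EuclideanSpace ℝ (Fin d) => a) (Metric.ball 0 r) :=
    integrableOn_const measure_ball_lt_top.ne
  have hball : ∫ z in Metric.ball (0 : EuclideanSpace ℝ (Fin d)) r, (a + ℓ z) = a * (r ^ d * m) := by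
    rw [integral_add hinta hintℓ, setIntegral_ball_clm_eq_zero, setIntegral_const,
      EuclideanSpace.volume_real_ball d 0 hr, smul_eq_mul, add_zero, mul_comm]
  have hdiff := setIntegral_sdiff hT (hinta.add hintℓ) hTr
  simp only [Pi.add_apply] at hdiff
  rw [← hball, abs_sub_comm, ← hdiff, ← Real.norm_eq_abs]
  have hfin : volume (Metric.ball (0 : EuclideanSpace ℝ (Fin d)) r \ T) < ⊤ :=
    (measure_mono Set.sdiff_subset).trans_lt measure_ball_lt_top
  refine (norm_setIntegral_le_of_norm_le_const (C := |a| + b * r) hfin fun z hz => ?_).trans ?_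
  · refine (norm_add_le _ _).trans (add_le_add le_rfl ((hℓ z).trans ?_))
    exact mul_le_mul_of_nonneg_left (by simpa using (Metric.mem_ball.1 hz.1).le) hb
  · refine mul_le_mul_of_nonneg_left ?_ (by positivity)
    rw [sub_mul, ← EuclideanSpace.volume_real_ball d 0 hr, ← EuclideanSpace.volume_real_ball d 0 hs,
      ← measureReal_sdiff hsr measurableSet_ball]
    exact measureReal_mono (Set.sdiff_subset_sdiff_right hsT)
      ((measure_mono Set.sdiff_subset).trans_lt measure_ball_lt_top).ne

namespace IsTamePatch

universe w

/-- After the change of variables to tangential coordinates, the integrand is affine up to a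
pointwise `O(r²)`, and the domain is caught between the balls of radii `r * (1 - P * r ^ 2)` and
`r`. Both errors are `O(r^(d+2))`. -/
theorem exists_expansion (d : ℕ) {c K j ε : ℝ} (hc : 0 < c) (hK : 0 < K) (hε : 0 < ε) :
    ∃ K' r₀ : ℝ, 0 < r₀ ∧ ∀ (F : Type w) [NormedAddCommGroup F] [InnerProductSpace ℝ F]
      [FiniteDimensional ℝ F]
      (φ : EuclideanSpace ℝ (Fin d) → F) (f : EuclideanSpace ℝ (Fin d) → ℝ)
      (W : Set (EuclideanSpace ℝ (Fin d))), IsTamePatch φ f W c K j →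
      ∀ u ∈ W, Metric.closedBall u ε ⊆ W → ∀ r, 0 < r → r < r₀ →
        |(∫ v in {v ∈ W | ‖φ v - φ u‖ < r}, f v * Real.sqrt (gramDet (fderiv ℝ φ v))) -
          f u * (r ^ d * volume.real (Metric.ball (0 : EuclideanSpace ℝ (Fin d)) 1))| ≤
          K' * r ^ (d + 2) := by
  obtain ⟨D, hD0, hD⟩ := exists_abs_sqrt_gramDet_sub_le.{w} d c K j
  set m := volume.real (Metric.ball (0 : EuclideanSpace ℝ (Fin d)) 1) with hm
  set P := (K * (2 / c) ^ 2) ^ 2 with hP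
  have hP0 : 0 < P := by positivity
  set Q := K * D + (K + K / c * K) * D with hQ
  -- The first term is the pointwise error `Q * (2 / c * r) ^ 2` times the volume of the domain, the
  -- second the bound of the affine function times the volume of the shell. The bounds on `r` serve,
  -- in order, to drop `r` from `K + K / c * r`, to stay in the ball covered by the projection, and
  -- to make the inner radius positive.
  refine ⟨Q * (2 / c) ^ 2 * (2 / c) ^ d * m + (K + K / c) * (d * P * m),
    min 1 (min (c / 2 * ε) (1 / (P + 1))), by positivity,
    fun F _ _ _ φ f W h u hu hεW r hr hr' => ?_⟩
  have hr1 : r < 1 := lt_of_lt_of_le hr' (min_le_left _ _)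
  have hr2 : r < c / 2 * ε := lt_of_lt_of_le hr' ((min_le_right _ _).trans (min_le_left _ _))
  have hr3 : P * r ^ 2 < 1 := by
    have h1 : r < 1 / (P + 1) := lt_of_lt_of_le hr' ((min_le_right _ _).trans (min_le_right _ _))
    rw [lt_div_iff₀ (by positivity)] at h1
    nlinarith
  have hinj : Function.Injective (fderiv ℝ φ u) := by
    refine (injective_iff_map_eq_zero _).2 fun x hx => ?_
    have h1 := h.le_norm_fderiv u hu x
    rw [hx, norm_zero] at h1
    exact norm_le_zero_iff.1 (by by_contra! h3; nlinarith)
  obtain ⟨A, hA, hA'⟩ := exists_coisometry (fderiv ℝ φ u) hinj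
  obtain ⟨ℓ, hℓ, hℓ'⟩ := h.exists_linear_approx hA hu hA'
  set S := {v ∈ W | ‖φ v - φ u‖ < r} with hS
  have hSW : S ⊆ W := fun v hv => hv.1
  have hφ : ContinuousOn φ W := fun v hv => (h.differentiableAt v hv).continuousAt.continuousWithinAt
  have hSo : IsOpen S :=
    (hφ.sub continuousOn_const).norm.isOpen_inter_preimage h.isOpen isOpen_Iio
  have hSm := hSo.measurableSet
  have hSb : S ⊆ Metric.ball u (2 / c * r) := fun v hv => by
    rw [mem_ball_iff_norm]
    refine (h.norm_sub_le_norm_projection hA hu hA' hv.1).trans_lt ?_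
    exact mul_lt_mul_of_pos_left ((hA _).trans_lt hv.2) (by positivity)
  have hSfin : volume S ≠ ⊤ := ((measure_mono hSb).trans_lt measure_ball_lt_top).ne
  have : IsFiniteMeasure (volume.restrict S) := ⟨by simpa using hSfin.lt_top⟩
  have hSvol : volume.real S ≤ (2 / c * r) ^ d * m := by
    rw [hm, ← EuclideanSpace.volume_real_ball d u (by positivity)]
    exact measureReal_mono hSb measure_ball_lt_top.ne
  have hDφ : ContinuousOn (fderiv ℝ φ) W := by
    have : LipschitzOnWith ⟨K, hK.le⟩ (fderiv ℝ φ) W :=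
      LipschitzOnWith.of_dist_le_mul fun x hx y hy => by
        rw [dist_eq_norm, dist_eq_norm]
        exact h.norm_fderiv_sub_le y hy x hx
    exact this.continuousOn
  have hf : ContinuousOn f W :=
    fun v hv => (h.differentiableAt_fun v hv).continuousAt.continuousWithinAt
  have hJ : ContinuousOn (fun v => Real.sqrt (gramDet (fderiv ℝ φ v))) W :=
    Real.continuous_sqrt.comp_continuousOn (continuous_gramDet.comp_continuousOn hDφ)
  have hdet : ContinuousOn (fun v => |(A ∘L fderiv ℝ φ v).det|) W :=
    (ContinuousLinearMap.continuous_det.comp_continuousOn (continuousOn_const.clm_comp hDφ)).abs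
  have hΨ : ContinuousOn (fun v => A (φ v - φ u)) W :=
    A.continuous.comp_continuousOn (hφ.sub continuousOn_const)
  have hv2 : ∀ v ∈ S, ‖v - u‖ ^ 2 ≤ (2 / c * r) ^ 2 := fun v hv => by
    have := (mem_ball_iff_norm.1 (hSb hv)).le
    gcongr
  have hpt : ∀ v ∈ S, ‖f v * Real.sqrt (gramDet (fderiv ℝ φ v)) -
      |(A ∘L fderiv ℝ φ v).det| * (f u + ℓ (A (φ v - φ u)))‖ ≤ Q * (2 / c * r) ^ 2 := by
    intro v hv
    obtain ⟨hd1, hd2⟩ := hD F φ f W h u hu A hA hA' v hv.1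
    have h1 : f v * Real.sqrt (gramDet (fderiv ℝ φ v)) -
        |(A ∘L fderiv ℝ φ v).det| * (f u + ℓ (A (φ v - φ u))) =
        f v * (Real.sqrt (gramDet (fderiv ℝ φ v)) - |(A ∘L fderiv ℝ φ v).det|) +
        (f v - (f u + ℓ (A (φ v - φ u)))) * |(A ∘L fderiv ℝ φ v).det| := by ring
    rw [h1, Real.norm_eq_abs]
    refine (abs_add_le _ _).trans ?_
    rw [abs_mul, abs_mul, abs_abs, hQ, add_mul]
    refine add_le_add ?_ ?_
    · rw [mul_assoc]
      refine mul_le_mul (h.abs_fun_le v hv.1) (hd2.trans ?_) (abs_nonneg _) hK.le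
      exact mul_le_mul_of_nonneg_left (hv2 v hv) hD0
    · rw [mul_right_comm]
      refine mul_le_mul ((hℓ' v hv.1).trans ?_) hd1 (abs_nonneg _) (by positivity)
      exact mul_le_mul_of_nonneg_left (hv2 v hv) (by positivity)
  have hΨS : ∀ v ∈ S, ‖A (φ v - φ u)‖ < r := fun v hv => (hA _).trans_lt hv.2
  have hint2 : IntegrableOn (fun v => |(A ∘L fderiv ℝ φ v).det| * (f u + ℓ (A (φ v - φ u)))) S := by
    refine Integrable.of_bound
      (((hdet.mul (continuousOn_const.add (ℓ.continuous.comp_continuousOn hΨ))).mono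
        hSW).aestronglyMeasurable hSm) (D * (K + K / c * r)) ?_
    filter_upwards [ae_restrict_mem hSm] with v hv
    rw [norm_mul, Real.norm_eq_abs, abs_abs, Real.norm_eq_abs]
    refine mul_le_mul (hD F φ f W h u hu A hA hA' v hv.1).1 ?_ (abs_nonneg _) hD0
    refine (abs_add_le _ _).trans (add_le_add (h.abs_fun_le u hu) ((hℓ _).trans ?_))
    exact mul_le_mul_of_nonneg_left (hΨS v hv).le (by positivity)
  have hint12 : IntegrableOn (fun v => f v * Real.sqrt (gramDet (fderiv ℝ φ v)) -
      |(A ∘L fderiv ℝ φ v).det| * (f u + ℓ (A (φ v - φ u)))) S := by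
    refine Integrable.of_bound
      ((((hf.mul hJ).sub (hdet.mul (continuousOn_const.add
        (ℓ.continuous.comp_continuousOn hΨ)))).mono hSW).aestronglyMeasurable hSm)
      (Q * (2 / c * r) ^ 2) ?_
    filter_upwards [ae_restrict_mem hSm] with v hv using hpt v hv
  have hint1 : IntegrableOn (fun v => f v * Real.sqrt (gramDet (fderiv ℝ φ v))) S := by
    refine (hint12.add hint2).congr_fun (fun v _ => ?_) hSm
    simp
  -- Change of variables to `z = A (φ v - φ u)`, which turns the approximate integral into that of
  -- an affine function over `T`.
  have hcov := integral_image_eq_integral_abs_det_fderiv_smul volume hSm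
    (fun v hv => (h.hasFDerivAt_projection (A := A) (u := u) (hSW hv)).hasFDerivWithinAt)
    ((h.injOn_projection hA hu hA').mono hSW) (fun z => f u + ℓ z)
  simp only [smul_eq_mul] at hcov
  set T := (fun v => A (φ v - φ u)) '' S with hT
  have hTm : MeasurableSet T := measurable_image_of_fderivWithin hSm
    (fun v hv => (h.hasFDerivAt_projection (A := A) (u := u) (hSW hv)).hasFDerivWithinAt)
    ((h.injOn_projection hA hu hA').mono hSW)
  have hs : 0 < r * (1 - P * r ^ 2) := mul_pos hr (by linarith)
  have hTr : T ⊆ Metric.ball 0 r := by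
    rintro _ ⟨v, hv, rfl⟩
    simpa using hΨS v hv
  have hsT : Metric.ball 0 (r * (1 - P * r ^ 2)) ⊆ T := by
    intro z hz
    have hz' : ‖z‖ < r * (1 - P * r ^ 2) := by simpa using hz
    have hzr : ‖z‖ < r := hz'.trans_le (by nlinarith [mul_pos hP0 (pow_pos hr 2)])
    obtain ⟨v, hv, rfl⟩ := h.surjOn_projection hA hu hA' hε.le hεW
      (show z ∈ Metric.closedBall 0 (c / 2 * ε) by simpa using (hzr.trans hr2).le)
    refine ⟨v, ⟨hεW hv, ?_⟩, rfl⟩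
    have h1 := h.norm_image_sub_sq_le hA hu hA' (hεW hv)
    simp only at hz' hzr
    -- With `‖z‖ < r(1 - Pr²)`, the squared distance is below `r²(1 - Pr²)² + Pr⁴ = r² - Pr⁴(1 -
    -- Pr²)`, which is at most `r²`.
    refine lt_of_pow_lt_pow_left₀ 2 hr.le (h1.trans_lt ?_)
    have h2 : ‖A (φ v - φ u)‖ ^ 2 < (r * (1 - P * r ^ 2)) ^ 2 := by gcongr
    have h3 : ‖A (φ v - φ u)‖ ^ 4 ≤ r ^ 4 := by gcongr
    have h4 : P * ‖A (φ v - φ u)‖ ^ 4 ≤ P * r ^ 4 := mul_le_mul_of_nonneg_left h3 hP0.le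
    have h5 : (r * (1 - P * r ^ 2)) ^ 2 = r ^ 2 - 2 * P * r ^ 4 + P * r ^ 4 * (P * r ^ 2) := by ring
    have h6 : P * r ^ 4 * (P * r ^ 2) ≤ P * r ^ 4 * 1 :=
      mul_le_mul_of_nonneg_left hr3.le (by positivity)
    linarith
  have haff := abs_setIntegral_affine_sub_le (a := f u) ℓ hTm hs hr hsT hTr (by positivity) hℓ
  rw [hcov, ← hm] at haff
  have hdiff := norm_setIntegral_le_of_norm_le_const (C := Q * (2 / c * r) ^ 2) hSfin.lt_top hpt
  rw [integral_sub hint1 hint2, Real.norm_eq_abs] at hdiff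
  have hm0 : 0 ≤ m := measureReal_nonneg
  have hQ0 : 0 ≤ Q := by positivity
  have e1 : Q * (2 / c * r) ^ 2 * volume.real S ≤
      Q * (2 / c) ^ 2 * (2 / c) ^ d * m * r ^ (d + 2) :=
    (mul_le_mul_of_nonneg_left hSvol (by positivity)).trans (le_of_eq (by ring))
  have e2 : (|f u| + K / c * r) * ((r ^ d - (r * (1 - P * r ^ 2)) ^ d) * m) ≤
      (K + K / c) * (d * P * m) * r ^ (d + 2) := by
    -- Bernoulli's inequality bounds the volume of the shell by `d * P * r ^ (d + 2) * m`.
    have hbern : 1 + (d : ℝ) * (-(P * r ^ 2)) ≤ (1 + (-(P * r ^ 2))) ^ d :=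
      one_add_mul_le_pow (by linarith) d
    have h1 : r ^ d - (r * (1 - P * r ^ 2)) ^ d ≤ r ^ d * (d * (P * r ^ 2)) := by
      rw [mul_pow, sub_eq_add_neg 1]
      nlinarith [pow_pos hr d]
    have h2 : (r ^ d - (r * (1 - P * r ^ 2)) ^ d) * m ≤ r ^ d * (d * (P * r ^ 2)) * m :=
      mul_le_mul_of_nonneg_right h1 hm0
    have h3 : |f u| + K / c * r ≤ K + K / c :=
      add_le_add (h.abs_fun_le u hu) (mul_le_of_le_one_right (by positivity) hr1.le)
    refine (mul_le_mul_of_nonneg_left h2 (by positivity)).trans ?_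
    refine (mul_le_mul_of_nonneg_right h3 (by positivity)).trans (le_of_eq (by ring))
  rw [add_mul]
  refine (abs_sub_le _ _ _).trans (add_le_add (hdiff.trans e1) (haff.trans e2))

end IsTamePatch

/-! ### Chernoff bounds for counts -/

/-- Chernoff's bound for the number of points of an i.i.d. sample that satisfy `P`. -/
theorem measureReal_pi_count_le {Ω : Type*} [MeasurableSpace Ω] (μ : Measure Ω)
    [IsProbabilityMeasure μ] {P : Ω → Prop} [DecidablePred P]
    (hP : MeasurableSet {y | P y}) (N : ℕ) (t k : ℝ) :
    (Measure.pi fun _ : Fin N => μ).real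
        {Y | t * k ≤ t * ∑ j : Fin N, if P (Y j) then (1 : ℝ) else 0} ≤
      Real.exp (-(t * k) + N * (μ.real {y | P y} * (Real.exp t - 1))) := by
  -- `ψ` is `exp (t * 1_P)` written as an affine function of the indicator, so its mean `1 + q (e^t
  -- - 1)` is immediate. The sign of `t` selects the tail.
  set ψ : Ω → ℝ := fun y => {y | P y}.indicator (fun _ => Real.exp t - 1) y + 1 with hψ
  have hψm : Measurable ψ := (measurable_const.indicator hP).add_const 1
  have hψe : ∀ y, ψ y = Real.exp (t * if P y then 1 else 0) := by
    intro y
    by_cases hy : P y <;> simp [hψ, hy]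
  have hψi : Integrable ({y | P y}.indicator fun _ => Real.exp t - 1) μ :=
    (integrable_const _).indicator hP
  have hint : ∫ y, ψ y ∂μ = μ.real {y | P y} * (Real.exp t - 1) + 1 := by
    rw [hψ, integral_add hψi (integrable_const _), integral_indicator hP]
    simp
  have hprod : ∀ Y : Fin N → Ω, ∏ j, ψ (Y j) =
      Real.exp (t * ∑ j : Fin N, if P (Y j) then (1 : ℝ) else 0) := by
    intro Y
    rw [Finset.mul_sum, Real.exp_sum]
    exact Finset.prod_congr rfl fun j _ => hψe _
  have hpi := integral_fintype_prod_eq_pow (ι := Fin N) (μ := μ) ψ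
  rw [hint, Fintype.card_fin] at hpi
  have hPi : Integrable (fun Y : Fin N → Ω => ∏ j, ψ (Y j)) (Measure.pi fun _ : Fin N => μ) :=
    Integrable.fintype_prod (f := fun _ => ψ) fun _ => hψi.add (integrable_const _)
  have hmk := mul_meas_ge_le_integral_of_nonneg (μ := Measure.pi fun _ : Fin N => μ)
    (ae_of_all _ fun Y => by simp only [hprod]; exact (Real.exp_pos _).le) hPi (Real.exp (t * k))
  rw [hpi] at hmk
  simp only [hprod, Real.exp_le_exp] at hmk
  have h1 : (μ.real {y | P y} * (Real.exp t - 1) + 1) ^ N ≤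
      Real.exp (N * (μ.real {y | P y} * (Real.exp t - 1))) := by
    rw [Real.exp_nat_mul]
    refine pow_le_pow_left₀ ?_ (Real.add_one_le_exp _) N
    rw [← hint]
    exact integral_nonneg fun y => by rw [hψe]; exact (Real.exp_pos _).le
  rw [Real.exp_add, Real.exp_neg, ← div_eq_inv_mul, le_div_iff₀ (Real.exp_pos _), mul_comm]
  exact hmk.trans h1

theorem measureReal_pi_count_lt_le {Ω : Type*} [MeasurableSpace Ω] (μ : Measure Ω)
    [IsProbabilityMeasure μ] {P : Ω → Prop} [DecidablePred P]
    (hP : MeasurableSet {y | P y}) (N k : ℕ) {ε : ℝ}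
    (hε : 0 ≤ ε) (hε' : ε ≤ 1 / 2) (hk : k * (1 + ε) ≤ N * μ.real {y | P y}) :
    (Measure.pi fun _ : Fin N => μ).real {Y | (∑ j : Fin N, if P (Y j) then 1 else 0) < k} ≤
      Real.exp (-(k * ε ^ 2 / 6)) := by
  -- With `t = -ε / 3` the exponent is at most `-kε²(2 - ε)/9`, and this is at most `-kε²/6` because
  -- `ε ≤ 1 / 2`.
  refine (measureReal_mono ?_).trans ((measureReal_pi_count_le μ hP N (-(ε / 3)) k).trans
    (Real.exp_le_exp.2 ?_))
  · intro Y hY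
    have h1 : ((∑ j : Fin N, if P (Y j) then 1 else 0 : ℕ) : ℝ) ≤ k := by
      have h0 : (∑ j : Fin N, if P (Y j) then 1 else 0) < k := hY
      exact_mod_cast h0.le
    push_cast at h1
    exact mul_le_mul_of_nonpos_left h1 (by linarith)
  · have h1 := (abs_le.1 (Real.abs_exp_sub_one_sub_id_le (x := -(ε / 3))
      (by rw [abs_neg, abs_of_nonneg] <;> linarith))).2
    have h2 : Real.exp (-(ε / 3)) - 1 ≤ -(ε / 3) + (ε / 3) ^ 2 := by nlinarith
    have h3 : -(ε / 3) + (ε / 3) ^ 2 ≤ 0 := by nlinarith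
    have h4 : N * (μ.real {y | P y} * (Real.exp (-(ε / 3)) - 1)) ≤
        k * (1 + ε) * (-(ε / 3) + (ε / 3) ^ 2) := by
      rw [← mul_assoc]
      exact (mul_le_mul_of_nonneg_left h2 (by positivity)).trans
        (mul_le_mul_of_nonpos_right hk h3)
    have h5 : (0 : ℝ) ≤ k * ε ^ 2 * (1 / 2 - ε) := by
      have : 0 ≤ 1 / 2 - ε := by linarith
      positivity
    nlinarith

theorem measureReal_pi_le_count_le {Ω : Type*} [MeasurableSpace Ω] (μ : Measure Ω)
    [IsProbabilityMeasure μ] {P : Ω → Prop} [DecidablePred P]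
    (hP : MeasurableSet {y | P y}) (N k : ℕ) {ε : ℝ}
    (hε : 0 ≤ ε) (hε' : ε ≤ 1 / 2) (hk : N * μ.real {y | P y} ≤ k * (1 - 5 / 6 * ε)) :
    (Measure.pi fun _ : Fin N => μ).real {Y | k ≤ ∑ j : Fin N, if P (Y j) then 1 else 0} ≤
      Real.exp (-(k * ε ^ 2 / 6)) := by
  -- The hypothesis reads `N q ≤ k (1 - 2a)`, so the exponent is at most `-k a² - 2k a³`; the choice
  -- suffices since `(5/12)² = 25/144 > 1/6`.
  set a := 5 / 12 * ε with ha
  refine (measureReal_mono ?_).trans ((measureReal_pi_count_le μ hP N a k).trans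
    (Real.exp_le_exp.2 ?_))
  · intro Y hY
    have h1 : (k : ℝ) ≤ ((∑ j : Fin N, if P (Y j) then 1 else 0 : ℕ) : ℝ) := by
      have h0 : k ≤ ∑ j : Fin N, if P (Y j) then 1 else 0 := hY
      exact_mod_cast h0
    push_cast at h1
    exact mul_le_mul_of_nonneg_left h1 (by positivity)
  · have h1 := (abs_le.1 (Real.abs_exp_sub_one_sub_id_le (x := a)
      (by rw [abs_of_nonneg] <;> linarith))).2
    have h2 : Real.exp a - 1 ≤ a + a ^ 2 := by linarith
    have h4 : N * (μ.real {y | P y} * (Real.exp a - 1)) ≤ k * (1 - 5 / 6 * ε) * (a + a ^ 2) := by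
      rw [← mul_assoc]
      exact (mul_le_mul_of_nonneg_left h2 (by positivity)).trans
        (mul_le_mul_of_nonneg_right hk (by positivity))
    have h5 : (0 : ℝ) ≤ k * ε ^ 2 := by positivity
    have h6 : (0 : ℝ) ≤ k * ε ^ 2 * ε := by positivity
    have h7 : k * (1 - 5 / 6 * ε) * (a + a ^ 2) = k * a - 25 / 144 * (k * ε ^ 2) -
      5 / 6 * (25 / 144) * (k * ε ^ 2 * ε) := by rw [ha]; ring
    nlinarith

/-! ### Existence of tame patches -/

/-- For `C²` maps the derivatives are locally Lipschitz. Halving the lower bounds at `u₀` and adding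
one to the upper bounds turns them into strict inequalities, which persist nearby. -/
theorem ContDiffAt.exists_isTamePatch {d : ℕ} {F : Type*} [NormedAddCommGroup F]
    [InnerProductSpace ℝ F] {φ : EuclideanSpace ℝ (Fin d) → F} {f : EuclideanSpace ℝ (Fin d) → ℝ}
    {u₀ : EuclideanSpace ℝ (Fin d)} (hφ : ContDiffAt ℝ 2 φ u₀) (hf : ContDiffAt ℝ 2 f u₀)
    (hinj : Function.Injective (fderiv ℝ φ u₀)) :
    ∃ c K j ρ₀ : ℝ, 0 < ρ₀ ∧ ∀ ρ, 0 < ρ → ρ ≤ ρ₀ → IsTamePatch φ f (Metric.ball u₀ ρ) c K j := by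
  have hφ1 : ContDiffAt ℝ 1 (fderiv ℝ φ) u₀ := hφ.fderiv_right (by norm_num)
  have hf1 : ContDiffAt ℝ 1 (fderiv ℝ f) u₀ := hf.fderiv_right (by norm_num)
  obtain ⟨K₁, t₁, ht₁, hK₁⟩ := hφ1.exists_lipschitzOnWith
  obtain ⟨K₂, t₂, ht₂, hK₂⟩ := hf1.exists_lipschitzOnWith
  obtain ⟨a, ha, hanti⟩ := LinearMap.exists_antilipschitzWith
    (fderiv ℝ φ u₀ : EuclideanSpace ℝ (Fin d) →ₗ[ℝ] F) (LinearMap.ker_eq_bot.2 hinj)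
  have ha' : (0 : ℝ) < a := ha
  set c : ℝ := (a : ℝ)⁻¹ / 2 with hc
  have hc0 : 0 < c := by positivity
  have hlow : ∀ w, 2 * c * ‖w‖ ≤ ‖fderiv ℝ φ u₀ w‖ := by
    intro w
    have h1 := hanti.le_mul_dist w 0
    rw [map_zero, dist_zero_right, dist_zero_right] at h1
    have h2 : 2 * c = (a : ℝ)⁻¹ := by rw [hc]; ring
    rw [h2, inv_mul_le_iff₀ ha']
    exact h1
  set j : ℝ := Real.sqrt (gramDet (fderiv ℝ φ u₀)) / 2 with hj
  have hs0 : 0 < Real.sqrt (gramDet (fderiv ℝ φ u₀)) := Real.sqrt_pos.2 (gramDet_pos _ hinj)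
  set K : ℝ := K₁ + K₂ + (‖fderiv ℝ φ u₀‖ + 1) + (‖fderiv ℝ f u₀‖ + 1) + (|f u₀| + 1) with hK
  have hK0 : 0 < K := by positivity
  have hn1 := K₁.coe_nonneg
  have hn2 := K₂.coe_nonneg
  have hn3 := norm_nonneg (fderiv ℝ φ u₀)
  have hn4 := norm_nonneg (fderiv ℝ f u₀)
  have hn5 := abs_nonneg (f u₀)
  have ev : ∀ᶠ v in 𝓝 u₀, v ∈ t₁ ∧ v ∈ t₂ ∧ DifferentiableAt ℝ φ v ∧ DifferentiableAt ℝ f v ∧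
      ‖fderiv ℝ φ v‖ < ‖fderiv ℝ φ u₀‖ + 1 ∧ ‖fderiv ℝ f v‖ < ‖fderiv ℝ f u₀‖ + 1 ∧
      |f v| < |f u₀| + 1 ∧ ‖fderiv ℝ φ v - fderiv ℝ φ u₀‖ < c ∧
      j < Real.sqrt (gramDet (fderiv ℝ φ v)) := by
    have c1 := hφ1.continuousAt
    have c2 := hf1.continuousAt
    have c3 := hf.continuousAt
    have e1 : ∀ᶠ v in 𝓝 u₀, v ∈ t₁ := ht₁
    have e2 : ∀ᶠ v in 𝓝 u₀, v ∈ t₂ := ht₂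
    refine e1.and (e2.and (((hφ.eventually (by decide)).mono
      fun v hv => hv.differentiableAt (by norm_num)).and (((hf.eventually (by decide)).mono
      fun v hv => hv.differentiableAt (by norm_num)).and ?_)))
    refine (c1.norm.eventually_lt_const (by linarith)).and
      ((c2.norm.eventually_lt_const (by linarith)).and
      ((c3.abs.eventually_lt_const (by linarith)).and (?_ : ∀ᶠ v in 𝓝 u₀, _ ∧ _)))
    refine ((c1.sub continuousAt_const).norm.eventually_lt_const (by simpa using hc0)).and
      (((Real.continuous_sqrt.comp continuous_gramDet).continuousAt.comp c1).eventually_const_lt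
        (?_ : j < Real.sqrt (gramDet (fderiv ℝ φ u₀))))
    rw [hj]; linarith
  obtain ⟨ρ₁, hρ₁, hball⟩ := Metric.eventually_nhds_iff_ball.1 ev
  -- Two points of the ball are at most `2 * ρ` apart, so `ρ ≤ c / (4 * K)` gives the condition
  -- `small`.
  refine ⟨c, K, j, min ρ₁ (c / (4 * K)), by positivity, fun ρ hρ hρ' => ?_⟩
  have hρ2 : ρ ≤ c / (4 * K) := hρ'.trans (min_le_right _ _)
  have hb : ∀ v ∈ Metric.ball u₀ ρ, _ := fun v hv =>
    hball v (Metric.ball_subset_ball (hρ'.trans (min_le_left _ _)) hv)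
  refine ⟨hc0, hK0, by positivity, Metric.isOpen_ball, convex_ball _ _,
    fun v hv => (hb v hv).2.2.1, fun v hv => ?_, fun u hu v hv => ?_, fun v hv w => ?_,
    fun v hv => (hb v hv).2.2.2.1, fun v hv => ?_, fun v hv => ?_, fun u hu v hv => ?_,
    fun v hv => (hb v hv).2.2.2.2.2.2.2.2.le, fun u hu v hv => ?_⟩
  · linarith [(hb v hv).2.2.2.2.1]
  · rw [← dist_eq_norm, ← dist_eq_norm]
    exact (hK₁.dist_le_mul v (hb v hv).1 u (hb u hu).1).trans
      (mul_le_mul_of_nonneg_right (by linarith) dist_nonneg)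
  · have h1 : fderiv ℝ φ v w = fderiv ℝ φ u₀ w + (fderiv ℝ φ v - fderiv ℝ φ u₀) w := by simp
    have h2 := norm_sub_norm_le (fderiv ℝ φ u₀ w) (-(fderiv ℝ φ v - fderiv ℝ φ u₀) w)
    have h3 := ContinuousLinearMap.le_of_opNorm_le _ (hb v hv).2.2.2.2.2.2.2.1.le w
    rw [h1]
    simp only [norm_neg, sub_neg_eq_add] at h2
    linarith [hlow w]
  · linarith [(hb v hv).2.2.2.2.2.2.1]
  · linarith [(hb v hv).2.2.2.2.2.1]
  · rw [← dist_eq_norm, ← dist_eq_norm]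
    exact (hK₂.dist_le_mul v (hb v hv).2.1 u (hb u hu).2.1).trans
      (mul_le_mul_of_nonneg_right (by linarith) dist_nonneg)
  · have h1 : ‖v - u‖ ≤ 2 * ρ := by
      rw [← dist_eq_norm]
      have := dist_triangle_right v u u₀
      have h2 := Metric.mem_ball.1 hu
      have h3 := Metric.mem_ball.1 hv
      linarith
    rw [le_div_iff₀ (by positivity)] at hρ2
    nlinarith

/-! ### From patches to the manifold -/

section Manifold

variable {d D : ℕ} {M : Type*} [TopologicalSpace M]
  [ChartedSpace (EuclideanSpace ℝ (Fin d)) M] [IsManifold (𝓡 d) ∞ M]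
  {g : ContMDiffRiemannianMetric (𝓡 d) ∞ (EuclideanSpace ℝ (Fin d))
    (fun x : M => TangentSpace (𝓡 d) x)}
  {ι : M → EuclideanSpace ℝ (Fin D)} {e : OpenPartialHomeomorph M (EuclideanSpace ℝ (Fin d))}
  {u : EuclideanSpace ℝ (Fin d)}

theorem ContMDiff.contDiffOn_comp_chart_symm {G : Type*} [NormedAddCommGroup G] [NormedSpace ℝ G]
    {f : M → G} (hf : ContMDiff (𝓡 d) 𝓘(ℝ, G) ∞ f)
    (he : e ∈ atlas (EuclideanSpace ℝ (Fin d)) M) : ContDiffOn ℝ ∞ (f ∘ e.symm) e.target :=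
  contMDiffOn_iff_contDiffOn.1 (hf.comp_contMDiffOn (contMDiffOn_symm_of_mem_maximalAtlas
    (IsManifold.subset_maximalAtlas (I := 𝓡 d) (n := ∞) he)))

theorem fderiv_comp_chart_symm (hι : ContMDiff (𝓡 d) (𝓡 D) ∞ ι)
    (he : e ∈ atlas (EuclideanSpace ℝ (Fin d)) M) (hu : u ∈ e.target)
    (v : EuclideanSpace ℝ (Fin d)) : fderiv ℝ (ι ∘ e.symm) u v =
      mfderiv (𝓡 d) (𝓡 D) ι (e.symm u) (mfderiv (𝓡 d) (𝓡 d) e.symm u v) := by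
  have hinf : (∞ : WithTop ℕ∞) ≠ 0 := by simp
  have d1 : MDifferentiableAt (𝓡 d) (𝓡 d) e.symm u :=
    ((contMDiffOn_symm_of_mem_maximalAtlas
      (IsManifold.subset_maximalAtlas (I := 𝓡 d) (n := ∞) he)).contMDiffAt
      (e.open_target.mem_nhds hu)).mdifferentiableAt hinf
  have h2 := mfderiv_comp (I := 𝓡 d) (I' := 𝓡 d) (I'' := 𝓡 D) u
    (g := ι) (f := e.symm) (hι.mdifferentiable hinf _) d1
  rw [mfderiv_eq_fderiv] at h2
  rw [h2]
  rfl

variable (hiso : ∀ (x : M) (v w : TangentSpace (𝓡 d) x),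
      g.inner x v w =
        inner ℝ (E := EuclideanSpace ℝ (Fin D))
          (mfderiv (𝓡 d) (𝓡 D) ι x v) (mfderiv (𝓡 d) (𝓡 D) ι x w))
include hiso

theorem det_chartGram_eq_gramDet (hι : ContMDiff (𝓡 d) (𝓡 D) ∞ ι)
    (he : e ∈ atlas (EuclideanSpace ℝ (Fin d)) M) (hu : u ∈ e.target) :
    (chartGram g e u).det = gramDet (fderiv ℝ (ι ∘ e.symm) u) := by
  unfold chartGram gramDet
  congr 1
  ext i j
  simp only [Matrix.of_apply]
  rw [fderiv_comp_chart_symm hι he hu, fderiv_comp_chart_symm hι he hu]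
  exact hiso _ _ _

/-- A kernel vector would have zero length for `g`, since the embedding is isometric, and `g` is
positive definite. -/
theorem injective_fderiv_comp_chart_symm (hι : ContMDiff (𝓡 d) (𝓡 D) ∞ ι)
    (he : e ∈ atlas (EuclideanSpace ℝ (Fin d)) M) (hu : u ∈ e.target) :
    Function.Injective (fderiv ℝ (ι ∘ e.symm) u) := by
  refine (injective_iff_map_eq_zero _).2 fun v hv => ?_
  rw [fderiv_comp_chart_symm hι he hu] at hv
  have h1 : mfderiv (𝓡 d) (𝓡 d) e.symm u v = 0 := by
    by_contra h
    have h2 := g.pos (e.symm u) _ h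
    rw [hiso, hv] at h2
    simp at h2
  have h3 := (mdifferentiable_of_mem_atlas (I := 𝓡 d) he).comp_symm_deriv hu
  have h4 : mfderiv (𝓡 d) (𝓡 d) e (e.symm u) (mfderiv (𝓡 d) (𝓡 d) e.symm u v) = v :=
    DFunLike.congr_fun h3 v
  rw [h1, map_zero] at h4
  exact h4.symm

theorem samplingMeasure_real_eq_setIntegral [MeasurableSpace M] [BorelSpace M]
    (hι : ContMDiff (𝓡 d) (𝓡 D) ∞ ι)
    (he : e ∈ atlas (EuclideanSpace ℝ (Fin d)) M) {p : M → ℝ} (hp : Continuous p)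
    (hp0 : ∀ x, 0 ≤ p x) {B : Set M} (hB : MeasurableSet B) (hBe : B ⊆ e.source)
    (hBm : MeasurableSet (e.target ∩ e.symm ⁻¹' B)) :
    (samplingMeasure g p).real B = ∫ u in e.target ∩ e.symm ⁻¹' B,
      p (e.symm u) * Real.sqrt (gramDet (fderiv ℝ (ι ∘ e.symm) u)) := by
  have hcont : ContinuousOn (fun u => Real.sqrt (gramDet (fderiv ℝ (ι ∘ e.symm) u))) e.target :=
    Real.continuous_sqrt.comp_continuousOn (continuous_gramDet.comp_continuousOn
      ((hι.contDiffOn_comp_chart_symm he).continuousOn_fderiv_of_isOpen e.open_target (by simp)))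
  have hpc : ContinuousOn (fun u => p (e.symm u)) e.target :=
    hp.comp_continuousOn e.continuousOn_symm
  have hTm := e.open_target.measurableSet
  have hm : AEMeasurable e.symm (volume.restrict e.target) :=
    e.continuousOn_symm.aemeasurable hTm
  have hac := withDensity_absolutelyContinuous (volume.restrict e.target)
    (fun u => ENNReal.ofReal (Real.sqrt (chartGram g e u).det))
  have hcont' : ContinuousOn (fun u => Real.sqrt (chartGram g e u).det) e.target :=
    hcont.congr fun u hu => by rw [det_chartGram_eq_gramDet hiso hι he hu]
  have hpm : Measurable (fun y => ENNReal.ofReal (p y)) := hp.measurable.ennreal_ofReal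
  have h1 : samplingMeasure g p B = ∫⁻ u in e.target ∩ e.symm ⁻¹' B,
      ENNReal.ofReal (p (e.symm u) * Real.sqrt (gramDet (fderiv ℝ (ι ∘ e.symm) u))) := by
    rw [samplingMeasure, withDensity_apply _ hB,
      ← Set.inter_eq_self_of_subset_left hBe, ← Measure.restrict_restrict hB,
      riemannianVolume_restrict_source g he, Set.inter_eq_self_of_subset_left hBe,
      ← lintegral_indicator hB, chartVolume,
      lintegral_map' (hpm.indicator hB).aemeasurable (hm.mono_ac hac),
      show (fun u => B.indicator (fun y => ENNReal.ofReal (p y)) (e.symm u)) =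
        (B.indicator fun y => ENNReal.ofReal (p y)) ∘ e.symm from rfl,
      lintegral_withDensity_eq_lintegral_mul₀ (hcont'.aemeasurable hTm).ennreal_ofReal
        ((hpm.indicator hB).comp_aemeasurable hm),
      Set.inter_comm, ← Measure.restrict_restrict₀ (hm.nullMeasurableSet_preimage hB),
      ← lintegral_indicator₀ (hm.nullMeasurableSet_preimage hB)]
    refine setLIntegral_congr_fun hTm fun u hu => ?_
    by_cases huB : e.symm u ∈ B
    · have huB' : u ∈ e.symm ⁻¹' B := huB
      simp only [Pi.mul_apply, Function.comp_apply, Set.indicator_of_mem huB,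
        Set.indicator_of_mem huB',
        det_chartGram_eq_gramDet hiso hι he hu]
      rw [ENNReal.ofReal_mul (hp0 _), mul_comm]
    · have huB' : u ∉ e.symm ⁻¹' B := huB
      simp [Set.indicator_of_notMem huB, Set.indicator_of_notMem huB']
  rw [measureReal_def, h1, integral_eq_lintegral_of_nonneg_ae
    (ae_of_all _ fun u => mul_nonneg (hp0 _) (Real.sqrt_nonneg _))
    (((hpc.mul hcont).mono Set.inter_subset_left).aestronglyMeasurable hBm)]

theorem exists_local_ball_expansion [MeasurableSpace M] [BorelSpace M]
    (hι : IsSmoothEmbedding (𝓡 d) (𝓡 D) ∞ ι)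
    {p : M → ℝ} (hp : ContMDiff (𝓡 d) 𝓘(ℝ, ℝ) ∞ p) (hp0 : ∀ x, 0 ≤ p x) (x₀ : M) :
    ∃ t ∈ 𝓝 x₀, ∃ K r₀ : ℝ, 0 < r₀ ∧ ∀ x ∈ t, ∀ r, 0 < r → r < r₀ →
      |(samplingMeasure g p).real {y | ‖ι y - ι x‖ < r} -
        p x * (r ^ d * volume.real (Metric.ball (0 : EuclideanSpace ℝ (Fin d)) 1))| ≤
        K * r ^ (d + 2) := by
  have hιs := hι.contMDiff
  set e := chartAt (EuclideanSpace ℝ (Fin d)) x₀ with hedef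
  have he : e ∈ atlas (EuclideanSpace ℝ (Fin d)) M := chart_mem_atlas _ x₀
  have hx₀ : x₀ ∈ e.source := mem_chart_source _ x₀
  have hu₀ : e x₀ ∈ e.target := e.map_source hx₀
  have hφ : ContDiffAt ℝ 2 (ι ∘ e.symm) (e x₀) :=
    ((hιs.contDiffOn_comp_chart_symm he).contDiffAt (e.open_target.mem_nhds hu₀)).of_le
      (WithTop.coe_le_coe.2 (le_top (a := (2 : ℕ∞))))
  have hf : ContDiffAt ℝ 2 (p ∘ e.symm) (e x₀) :=
    ((hp.contDiffOn_comp_chart_symm he).contDiffAt (e.open_target.mem_nhds hu₀)).of_le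
      (WithTop.coe_le_coe.2 (le_top (a := (2 : ℕ∞))))
  obtain ⟨c, K, j, ρ₀, hρ₀, hpatch⟩ := hφ.exists_isTamePatch hf
    (injective_fderiv_comp_chart_symm hiso hιs he hu₀)
  obtain ⟨ρ₁, hρ₁, hρ₁T⟩ := Metric.isOpen_iff.1 e.open_target _ hu₀
  set ρ := min ρ₀ ρ₁ with hρdef
  have hρ : 0 < ρ := by positivity
  set W := Metric.ball (e x₀) ρ with hW
  have hWT : W ⊆ e.target := (Metric.ball_subset_ball (min_le_right _ _)).trans hρ₁T
  have hP := hpatch ρ hρ (min_le_left _ _)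
  obtain ⟨K', r₁, hr₁, hexp⟩ := IsTamePatch.exists_expansion d (j := j) hP.c_pos hP.K_pos
    (half_pos (half_pos hρ))
  have hVopen : IsOpen (e.source ∩ e ⁻¹' W) := e.isOpen_inter_preimage Metric.isOpen_ball
  have hVx : e.source ∩ e ⁻¹' W ∈ 𝓝 x₀ :=
    hVopen.mem_nhds ⟨hx₀, Metric.mem_ball_self hρ⟩
  -- Only here is it used that `ι` is a topological embedding: points close in the ambient space are
  -- close on the manifold, so the whole ambient ball lies in one chart.
  rw [hι.isEmbedding.isInducing.nhds_eq_comap] at hVx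
  obtain ⟨r₂, hr₂, hr₂V⟩ := (Metric.nhds_basis_ball.comap ι).mem_iff.1 hVx
  refine ⟨(e.source ∩ e ⁻¹' Metric.ball (e x₀) (ρ / 2)) ∩ ι ⁻¹' Metric.ball (ι x₀) (r₂ / 2),
    inter_mem ((e.isOpen_inter_preimage Metric.isOpen_ball).mem_nhds
      ⟨hx₀, Metric.mem_ball_self (half_pos hρ)⟩)
      ((Metric.isOpen_ball.preimage hιs.continuous).mem_nhds (Metric.mem_ball_self (half_pos hr₂))),
    K', min r₁ (r₂ / 2), by positivity, ?_⟩
  rintro x ⟨⟨hxe, hxW⟩, hxr⟩ r hr hr'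
  have hxρ : e x ∈ Metric.ball (e x₀) (ρ / 2) := hxW
  have hxW' : e x ∈ W := Metric.ball_subset_ball (by linarith) hxρ
  set B := {y | ‖ι y - ι x‖ < r} with hB
  have hBV : B ⊆ e.source ∩ e ⁻¹' W := fun y hy => hr₂V (by
    have h1 : dist (ι y) (ι x) < r := by rw [dist_eq_norm]; exact hy
    have h2 : dist (ι x) (ι x₀) < r₂ / 2 := hxr
    have h3 := dist_triangle (ι y) (ι x) (ι x₀)
    have h4 := hr'.trans_le (min_le_right _ _)
    exact Metric.mem_ball.2 (by linarith))
  have hBo : IsOpen B := isOpen_lt (by have := hιs.continuous; fun_prop) continuous_const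
  have hset : e.target ∩ e.symm ⁻¹' B =
      {v ∈ W | ‖(ι ∘ e.symm) v - (ι ∘ e.symm) (e x)‖ < r} := by
    ext v
    simp only [Set.mem_inter_iff, Set.mem_preimage, Set.mem_ofPred_eq, Function.comp_apply,
      e.left_inv hxe, hB]
    constructor
    · rintro ⟨hv, hvB⟩
      refine ⟨?_, hvB⟩
      have := (hBV hvB).2
      rwa [Set.mem_preimage, e.right_inv hv] at this
    · rintro ⟨hv, hvB⟩
      exact ⟨hWT hv, hvB⟩
  have hmeas : MeasurableSet (e.target ∩ e.symm ⁻¹' B) :=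
    (e.isOpen_inter_preimage_symm hBo).measurableSet
  rw [samplingMeasure_real_eq_setIntegral hiso hιs he hp.continuous hp0 hBo.measurableSet
    (fun y hy => (hBV hy).1) hmeas, hset]
  have hcl : Metric.closedBall (e x) (ρ / 2 / 2) ⊆ W := fun v hv => by
    have h1 := Metric.mem_closedBall.1 hv
    have h2 := Metric.mem_ball.1 hxρ
    have h3 := dist_triangle v (e x) (e x₀)
    exact Metric.mem_ball.2 (by linarith)
  have := hexp _ (ι ∘ e.symm) (p ∘ e.symm) W hP (e x) hxW' hcl r hr
    (hr'.trans_le (min_le_left _ _))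
  simpa only [Function.comp_apply, e.left_inv hxe] using this

/-- The measure of small Euclidean balls, to second order and uniformly in the centre. -/
theorem exists_uniform_ball_expansion [CompactSpace M] [MeasurableSpace M] [BorelSpace M]
    (hι : IsSmoothEmbedding (𝓡 d) (𝓡 D) ∞ ι)
    {p : M → ℝ} (hp : ContMDiff (𝓡 d) 𝓘(ℝ, ℝ) ∞ p) (hp0 : ∀ x, 0 ≤ p x) :
    ∃ K r₀ : ℝ, 0 < K ∧ 0 < r₀ ∧ ∀ x, ∀ r, 0 < r → r < r₀ →
      |(samplingMeasure g p).real {y | ‖ι y - ι x‖ < r} -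
        p x * (r ^ d * volume.real (Metric.ball (0 : EuclideanSpace ℝ (Fin d)) 1))| ≤
        K * r ^ (d + 2) := by
  -- The property passes to subsets and to unions of two sets, and it holds near each point, so
  -- compactness gives it globally.
  have key := isCompact_univ.induction_on (X := M) (p := fun t => ∃ K r₀ : ℝ, 0 < r₀ ∧
    ∀ x ∈ t, ∀ r, 0 < r → r < r₀ →
      |(samplingMeasure g p).real {y | ‖ι y - ι x‖ < r} -
        p x * (r ^ d * volume.real (Metric.ball (0 : EuclideanSpace ℝ (Fin d)) 1))| ≤
        K * r ^ (d + 2)) ⟨0, 1, one_pos, fun x hx => hx.elim⟩ ?_ ?_ ?_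
  · obtain ⟨K, r₀, hr₀, h⟩ := key
    exact ⟨max K 1, r₀, by positivity, hr₀, fun x r hr hr' => (h x trivial r hr hr').trans
      (mul_le_mul_of_nonneg_right (le_max_left _ _) (by positivity))⟩
  · rintro s t hst ⟨K, r₀, hr₀, h⟩
    exact ⟨K, r₀, hr₀, fun x hx => h x (hst hx)⟩
  · rintro s t ⟨K, r₀, hr₀, h⟩ ⟨K', r₀', hr₀', h'⟩
    refine ⟨max K K', min r₀ r₀', by positivity, fun x hx r hr hr' => ?_⟩
    rcases hx with hx | hx
    · exact (h x hx r hr (hr'.trans_le (min_le_left _ _))).trans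
        (mul_le_mul_of_nonneg_right (le_max_left _ _) (by positivity))
    · exact (h' x hx r hr (hr'.trans_le (min_le_right _ _))).trans
        (mul_le_mul_of_nonneg_right (le_max_right _ _) (by positivity))
  · intro x _
    obtain ⟨t, ht, h⟩ := exists_local_ball_expansion hiso hι hp hp0 x
    exact ⟨t, mem_nhdsWithin_of_mem_nhds ht, h⟩

end Manifold

/-! ### The nearest neighbour radius and its concentration -/

theorem m0_knnKernel (d : ℕ) :
    m0 d knnKernel = volume.real (Metric.ball (0 : EuclideanSpace ℝ (Fin d)) 1) := by
  have h : (fun u : EuclideanSpace ℝ (Fin d) => knnKernel (‖u‖ ^ 2)) =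
      (Metric.ball (0 : EuclideanSpace ℝ (Fin d)) 1).indicator 1 := by
    funext u
    have : ‖u‖ ^ 2 ∈ Set.Ico (0 : ℝ) 1 ↔ u ∈ Metric.ball (0 : EuclideanSpace ℝ (Fin d)) 1 := by
      rw [mem_ball_zero_iff, Set.mem_Ico, sq_lt_one_iff₀ (norm_nonneg u)]
      exact and_iff_right (sq_nonneg _)
    by_cases hu : u ∈ Metric.ball (0 : EuclideanSpace ℝ (Fin d)) 1
    · rw [knnKernel, Set.indicator_of_mem (this.2 hu), Set.indicator_of_mem hu, Pi.one_apply]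
    · rw [knnKernel, Set.indicator_of_notMem (mt this.1 hu), Set.indicator_of_notMem hu]
  rw [m0, h, integral_indicator_one measurableSet_ball]

/-- The radius is squeezed by the counts at two radii. -/
theorem abs_knnRadius_sub_le {D N : ℕ} {M : Type*} (ι : M → EuclideanSpace ℝ (Fin D)) (k : ℕ)
    (Y : Fin N → M) (x : M) {R δ : ℝ} (hR : 0 < R + δ)
    (h1 : k ≤ ∑ j : Fin N, if ‖ι (Y j) - ι x‖ < R + δ then 1 else 0)
    (h2 : (∑ j : Fin N, if ‖ι (Y j) - ι x‖ < R - δ then 1 else 0) < k) :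
    |knnRadius ι k Y x - R| ≤ δ := by
  have hle : knnRadius ι k Y x ≤ R + δ := csInf_le ⟨0, fun r hr => hr.1.le⟩ ⟨hR, h1⟩
  have hge : R - δ ≤ knnRadius ι k Y x := by
    refine le_csInf ⟨_, hR, h1⟩ fun r hr => ?_
    by_contra! hlt
    refine (h2.trans_le hr.2).not_ge (Finset.sum_le_sum fun j _ => ?_)
    split_ifs with h3 h4
    · rfl
    · exact absurd (h3.trans hlt) h4
    · exact zero_le_one
    · rfl
  rw [abs_le]
  constructor <;> linarith

/-- Concentration of the nearest neighbour radius at a scale `R` where the masses of balls are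
known. -/
theorem le_measureReal_pi_abs_knnRadius_sub_le {D : ℕ} {M : Type*} [MeasurableSpace M]
    (μ : Measure M) [IsProbabilityMeasure μ] (ι : M → EuclideanSpace ℝ (Fin D))
    (hι : Measurable ι) (x : M) (N k : ℕ) {R δ ε : ℝ} (hε : 0 ≤ ε) (hε' : ε ≤ 1 / 2)
    (hR : 0 < R + δ) (h1 : k * (1 + ε) ≤ N * μ.real {y | ‖ι y - ι x‖ < R + δ})
    (h2 : N * μ.real {y | ‖ι y - ι x‖ < R - δ} ≤ k * (1 - 5 / 6 * ε)) :
    1 - 2 * Real.exp (-(k * ε ^ 2 / 6)) ≤ (Measure.pi fun _ : Fin N => μ).real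
      {Y : Fin N → M | |knnRadius ι k Y x - R| ≤ δ} := by
  have hballm : ∀ r, MeasurableSet {y | ‖ι y - ι x‖ < r} := fun r =>
    measurableSet_lt (hι.sub_const (ι x)).norm measurable_const
  have hb1 := measureReal_pi_count_lt_le μ (hballm (R + δ)) N k hε hε' h1
  have hb2 := measureReal_pi_le_count_le μ (hballm (R - δ)) N k hε hε' h2
  set B₁ := {Y : Fin N → M | (∑ j : Fin N, if ‖ι (Y j) - ι x‖ < R + δ then 1 else 0) < k}
  set B₂ := {Y : Fin N → M | k ≤ ∑ j : Fin N, if ‖ι (Y j) - ι x‖ < R - δ then 1 else 0}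
  set G := {Y : Fin N → M | |knnRadius ι k Y x - R| ≤ δ}
  have hcover : Set.univ ⊆ G ∪ (B₁ ∪ B₂) := by
    intro Y _
    by_cases hY : Y ∈ B₁ ∪ B₂
    · exact Or.inr hY
    · exact Or.inl (abs_knnRadius_sub_le ι k Y x hR (le_of_not_gt fun h => hY (Or.inl h))
        (lt_of_not_ge fun h => hY (Or.inr h)))
  have h3 : (1 : ℝ) ≤ (Measure.pi fun _ : Fin N => μ).real (G ∪ (B₁ ∪ B₂)) := by
    rw [← probReal_univ (μ := Measure.pi fun _ : Fin N => μ)]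
    exact measureReal_mono hcover
  have h4 := measureReal_union_le (μ := Measure.pi fun _ : Fin N => μ) G (B₁ ∪ B₂)
  have h5 := measureReal_union_le (μ := Measure.pi fun _ : Fin N => μ) B₁ B₂
  linarith

/-- With `P = p x` and `a = k / N` this is `ρ̄ = R b`, where `b` is the factor that turns `R̂` into
`ρ̂`. -/
theorem rpow_neg_one_div_eq_mul {d : ℕ} {P a m : ℝ} (hP : 0 < P) (ha : 0 < a) (hm : 0 < m) :
    P ^ (-1 / (d : ℝ)) = (a / (m * P)) ^ (1 / (d : ℝ)) * (1 / m * a) ^ (-1 / (d : ℝ)) := by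
  have h1 : a / (m * P) = (1 / m * a) * P⁻¹ := by field_simp
  have h2 : 0 < 1 / m * a := by positivity
  rw [h1, Real.mul_rpow h2.le (by positivity), mul_right_comm, ← Real.rpow_add h2,
    Real.inv_rpow hP.le, ← Real.rpow_neg hP.le]
  have h3 : 1 / (d : ℝ) + -1 / (d : ℝ) = 0 := by ring
  rw [h3, Real.rpow_zero, one_mul, neg_div]

/-- How the mass `q` of a ball whose radius is a perturbation of the ideal radius `R` compares with
the ideal mass `a`. -/
theorem ball_mass_bounds {d : ℕ} (hd : 0 < d) {R P a m K pmin κ η C ε E : ℝ} (hR : 0 < R)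
    (hm : 0 < m) (hpmin : 0 < pmin) (hP : pmin ≤ P) (hK : 0 < K) (hη : 0 < η) (hκ : 0 < κ)
    (hε : 0 ≤ ε)
    (hRd : P * (R ^ d * m) = a) (hR2 : R ^ 2 ≤ κ * η)
    (hC : C = 2 * (4 * K * κ / (m * pmin)) + 1) (hE : E = C * η + ε / d) (hdE : d * E ≤ 1 / 6) :
    (∀ q, |q - P * ((R + R * E) ^ d * m)| ≤ K * (R + R * E) ^ (d + 2) → a * (1 + ε) ≤ q) ∧
    (∀ q, |q - P * ((R - R * E) ^ d * m)| ≤ K * (R - R * E) ^ (d + 2) →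
      q ≤ a * (1 - 5 / 6 * ε)) := by
  set K' := 4 * K * κ / (m * pmin) with hK'
  have hK'0 : 0 < K' := by positivity
  have hC0 : 0 < C := by linarith
  have hP0 : 0 < P := hpmin.trans_le hP
  have ha0 : 0 < a := by rw [← hRd]; positivity
  have hd1 : (1 : ℝ) ≤ d := by exact_mod_cast hd
  have hE0 : 0 < E := by rw [hE]; positivity
  have hE1 : E ≤ 1 / 6 := (le_mul_of_one_le_left hE0.le hd1).trans hdE
  have hdE' : d * E = d * C * η + ε := by rw [hE]; field_simp
  have hdC : 2 * K' * η ≤ d * C * η := by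
    refine mul_le_mul_of_nonneg_right ?_ hη.le
    nlinarith
  -- The remainder `K r^(d+2)` is at most `K' * η` relative to the main term: `R ^ d` is compared
  -- with `a` through `pmin`, and `(R * z) ^ 2 ≤ 4 * κ * η`.
  have herr : ∀ z : ℝ, 0 ≤ z → z ≤ 2 → K * (R * z) ^ (d + 2) ≤ a * z ^ d * (K' * η) := by
    intro z hz hz2
    have h1 : (R * z) ^ 2 ≤ 4 * κ * η := by
      have : z ^ 2 ≤ 4 := by nlinarith
      rw [mul_pow]
      nlinarith [sq_nonneg R]
    have h2 : K * R ^ d ≤ a * (K / (m * pmin)) := by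
      rw [← hRd, mul_div_assoc', le_div_iff₀ (by positivity)]
      have : 0 < R ^ d * m * K := by positivity
      nlinarith
    calc K * (R * z) ^ (d + 2) = K * R ^ d * z ^ d * (R * z) ^ 2 := by ring
      _ ≤ a * (K / (m * pmin)) * z ^ d * (4 * κ * η) := by gcongr
      _ = a * z ^ d * (K' * η) := by rw [hK']; ring
  have hmain : ∀ z : ℝ, P * ((R * z) ^ d * m) = a * z ^ d := fun z => by
    rw [← hRd]; ring
  constructor
  · intro q hq
    rw [show R + R * E = R * (1 + E) by ring, hmain] at hq
    have h1 := (abs_le.1 hq).1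
    have h2 := herr (1 + E) (by linarith) (by linarith)
    have h3 : 1 + d * E ≤ (1 + E) ^ d := one_add_mul_le_pow (by linarith) d
    have h4 : a * ((1 + d * E) * (1 - K' * η)) ≤ a * ((1 + E) ^ d * (1 - K' * η)) :=
      mul_le_mul_of_nonneg_left (mul_le_mul_of_nonneg_right h3 (by linarith)) ha0.le
    -- The gain is `d * E ≥ 2 * K' * η + ε`, while the loss `(1 + d * E) * K' * η` is at most `7 / 6
    -- * K' * η`.
    have h5 : 1 + ε ≤ (1 + d * E) * (1 - K' * η) := by
      have : 0 < K' * η := by positivity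
      nlinarith
    have h6 := mul_le_mul_of_nonneg_left h5 ha0.le
    linarith
  · intro q hq
    rw [show R - R * E = R * (1 - E) by ring, hmain] at hq
    have h1 := (abs_le.1 hq).2
    have h2 := herr (1 - E) (by linarith) (by linarith)
    have hdE0 : 0 ≤ d * E := by positivity
    -- `exp (-x) ≤ 1 - x + x ^ 2` with `x = d * E ≤ 1 / 6`; this is the origin of the factor `5 /
    -- 6`.
    have h3 : (1 - E) ^ d ≤ 1 - 5 / 6 * (d * E) := by
      have e1 : (1 - E) ^ d ≤ Real.exp (-E) ^ d :=
        pow_le_pow_left₀ (by linarith) (Real.one_sub_le_exp_neg E) d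
      rw [← Real.exp_nat_mul] at e1
      have e2 := (abs_le.1 (Real.abs_exp_sub_one_sub_id_le (x := d * -E)
        (by rw [mul_neg, abs_neg, abs_of_nonneg] <;> linarith))).2
      nlinarith
    have hKη : 0 < K' * η := by positivity
    -- The factor 2 in `C` pays for the bias here: `5 / 6 * (2 * K' * η)` exceeds `K' * η`.
    have h5 : (1 - E) ^ d * (1 + K' * η) ≤ 1 - 5 / 6 * ε := by
      refine (mul_le_mul_of_nonneg_right h3 (by linarith)).trans ?_
      nlinarith
    have h6 := mul_le_mul_of_nonneg_left h5 ha0.le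
    linarith

/-- The constant 3 of the theorem makes the exponent `3 / 2 * s * log x`, strictly more than `s *
log x`; hence the strict inequality. -/
theorem exp_neg_mul_sq_lt_rpow_neg {x k s : ℝ} (hx : 1 < x) (hk : 0 < k) (hs : 0 < s) :
    Real.exp (-(k * (3 * Real.sqrt (s * Real.log x / k)) ^ 2 / 6)) < x ^ (-s) := by
  have hlog : 0 < Real.log x := Real.log_pos hx
  have h1 : k * (3 * Real.sqrt (s * Real.log x / k)) ^ 2 = 9 * (s * Real.log x) := by
    rw [mul_pow, Real.sq_sqrt (by positivity)]
    field_simp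
    norm_num
  rw [Real.rpow_def_of_pos (by linarith), Real.exp_lt_exp, h1]
  nlinarith [mul_pos hs hlog]

theorem eventually_error_small {d : ℕ} (hd : 0 < d) {C s b₁ b₂ : ℝ}
    (hb₁ : 0 < b₁) (hb₂ : 0 < b₂) {k : ℕ → ℕ}
    (hk : (fun N => (k N : ℝ)) =o[atTop] (fun N => (N : ℝ)))
    (hk' : Tendsto (fun N => (k N : ℝ) / Real.log (N : ℝ)) atTop atTop) :
    ∀ᶠ N : ℕ in atTop, 2 ≤ N ∧ 0 < k N ∧ ((k N : ℝ) / N) ^ (2 / (d : ℝ)) < b₁ ∧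
      d * (C * ((k N : ℝ) / N) ^ (2 / (d : ℝ)) +
        3 / (d : ℝ) * Real.sqrt (s * Real.log N / k N)) < b₂ := by
  have hd' : (0 : ℝ) < d := by exact_mod_cast hd
  have t1 : Tendsto (fun N : ℕ => ((k N : ℝ) / N) ^ (2 / (d : ℝ))) atTop (𝓝 0) := by
    have := hk.tendsto_div_nhds_zero.rpow_const (p := 2 / (d : ℝ)) (Or.inr (by positivity))
    rwa [Real.zero_rpow (by positivity)] at this
  have t2 : Tendsto (fun N : ℕ => Real.sqrt (s * Real.log N / k N)) atTop (𝓝 0) := by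
    have h1 := (hk'.inv_tendsto_atTop.const_mul s).sqrt
    rw [mul_zero, Real.sqrt_zero] at h1
    refine h1.congr fun N => ?_
    rw [Pi.inv_apply, inv_div, mul_div_assoc]
  have t3 := ((t1.const_mul C).add (t2.const_mul (3 / (d : ℝ)))).const_mul (d : ℝ)
  simp only [mul_zero, add_zero] at t3
  filter_upwards [eventually_ge_atTop 2, hk'.eventually_gt_atTop 0, t1.eventually_lt_const hb₁,
    t3.eventually_lt_const hb₂] with N h1 h2 h3 h4
  refine ⟨h1, ?_, h3, h4⟩
  rcases Nat.eq_zero_or_pos (k N) with h | h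
  · simp [h] at h2
  · exact h

/-! ### The theorem -/

theorem proposition2p2 {d D : ℕ} (hd : 0 < d)
    {M : Type*} [TopologicalSpace M] [CompactSpace M]
    [ChartedSpace (EuclideanSpace ℝ (Fin d)) M] [IsManifold (𝓡 d) ∞ M]
    [MeasurableSpace M] [BorelSpace M]
    -- the Riemannian metric of `M` and the isometric embedding into `ℝ^D`
    (g : ContMDiffRiemannianMetric (𝓡 d) ∞ (EuclideanSpace ℝ (Fin d))
      (fun x : M => TangentSpace (𝓡 d) x))
    (ι : M → EuclideanSpace ℝ (Fin D))
    (hι : IsSmoothEmbedding (𝓡 d) (𝓡 D) ∞ ι)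
    (hiso : ∀ (x : M) (v w : TangentSpace (𝓡 d) x),
      g.inner x v w =
        inner ℝ (E := EuclideanSpace ℝ (Fin D))
          (mfderiv (𝓡 d) (𝓡 D) ι x v) (mfderiv (𝓡 d) (𝓡 D) ι x w))
    -- the density
    (p : M → ℝ) (hp : ContMDiff (𝓡 d) 𝓘(ℝ, ℝ) ∞ p)
    (hbound : ∃ pmin pmax : ℝ, 0 < pmin ∧ 0 < pmax ∧ ∀ x, pmin ≤ p x ∧ p x ≤ pmax)
    (hdensity : ∫⁻ y, ENNReal.ofReal (p y) ∂(riemannianVolume g) = 1) :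
    ∃ C : ℝ, 0 < C ∧
      ∀ k : ℕ → ℕ,
        (fun N => (k N : ℝ)) =o[atTop] (fun N => (N : ℝ)) →
        Tendsto (fun N => (k N : ℝ) / Real.log (N : ℝ)) atTop atTop →
        ∀ s : ℝ, 0 < s →
          ∃ N₀ : ℕ, ∀ N : ℕ, N₀ ≤ N → ∀ x : M,
            1 - 2 * (N : ℝ) ^ (-s) <
              (Measure.pi fun _ : Fin N => samplingMeasure g p).real
                {Y : Fin N → M |
                  |rhoHat d ι (k N) Y x - rhoBar d p x| / rhoBar d p x ≤
                    C * ((k N : ℝ) / (N : ℝ)) ^ (2 / (d : ℝ)) +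
                      3 / (d : ℝ) * Real.sqrt (s * Real.log (N : ℝ) / (k N : ℝ))} := by
  obtain ⟨pmin, pmax, hpmin, -, hpb⟩ := hbound
  have hp0 : ∀ x, 0 < p x := fun x => hpmin.trans_le (hpb x).1
  obtain ⟨K, r₀, hK, hr₀, hexp⟩ :=
    exists_uniform_ball_expansion hiso hι hp fun x => (hp0 x).le
  have hprob : IsProbabilityMeasure (samplingMeasure g p) :=
    ⟨by rw [samplingMeasure, withDensity_apply _ MeasurableSet.univ, Measure.restrict_univ,
      hdensity]⟩
  set m := volume.real (Metric.ball (0 : EuclideanSpace ℝ (Fin d)) 1) with hmdef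
  have hm : 0 < m := ENNReal.toReal_pos (Metric.measure_ball_pos _ _ one_pos).ne'
    measure_ball_lt_top.ne
  have hd' : (0 : ℝ) < d := by exact_mod_cast hd
  have hd1 : (1 : ℝ) ≤ d := by exact_mod_cast hd
  set κ : ℝ := (1 / (m * pmin)) ^ (2 / (d : ℝ)) with hκdef
  have hκ : 0 < κ := by positivity
  set K' := 4 * K * κ / (m * pmin) with hK'
  have hK'0 : 0 < K' := by positivity
  -- `C` is fixed by the ball expansion, `pmin` and `d`, before `k` and `s` are chosen.
  refine ⟨2 * K' + 1, by positivity, fun k hk hk' s hs => ?_⟩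
  -- Neither condition involves `x`, so `N₀` is uniform. The first gives `(2 * R) ^ 2 ≤ 4 * κ * η <
  -- r₀ ^ 2`, so that the radii `R ± R * E` lie in the range of the expansion; the second gives `d *
  -- E < 1 / 6`, hence `E < 1 / 6` and `ε ≤ 1 / 2`.
  obtain ⟨N₀, hN₀⟩ := eventually_atTop.1 (eventually_error_small hd (C := 2 * K' + 1) (s := s)
    (b₁ := r₀ ^ 2 / (4 * κ)) (b₂ := 1 / 6) (by positivity) (by norm_num) hk hk')
  refine ⟨N₀, fun N hN x => ?_⟩
  obtain ⟨hN2, hk0, hη, hdE⟩ := hN₀ N hN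
  have hNpos : (0 : ℝ) < N := by exact_mod_cast (by omega : 0 < N)
  have hkpos : (0 : ℝ) < k N := by exact_mod_cast hk0
  set a : ℝ := (k N : ℝ) / N with hadef
  have ha : 0 < a := by positivity
  set η := a ^ (2 / (d : ℝ)) with hηdef
  have hη0 : 0 < η := by positivity
  set ε := 3 * Real.sqrt (s * Real.log N / k N) with hεdef
  have hε0 : 0 ≤ ε := by positivity
  set E := (2 * K' + 1) * η + 3 / (d : ℝ) * Real.sqrt (s * Real.log N / k N) with hEdef
  have hE : E = (2 * K' + 1) * η + ε / d := by rw [hEdef, hεdef]; ring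
  have hE0 : 0 < E := by rw [hE]; positivity
  have hE1 : E < 1 / 6 := (le_mul_of_one_le_left hE0.le hd1).trans_lt hdE
  have hε1 : ε ≤ 1 / 2 := by
    have h1 : d * E = d * (2 * K' + 1) * η + ε := by rw [hE]; field_simp
    have h2 : 0 < d * (2 * K' + 1) * η := by positivity
    linarith
  -- The ideal radius, at which the leading term of the mass equals `k / N`.
  set R := (a / (m * p x)) ^ (1 / (d : ℝ)) with hRdef
  have hpx := hp0 x
  have hR : 0 < R := by positivity
  have hRd : p x * (R ^ d * m) = a := by
    rw [hRdef, ← Real.rpow_natCast, ← Real.rpow_mul (by positivity), one_div,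
      inv_mul_cancel₀ hd'.ne', Real.rpow_one]
    field_simp
  have hR2 : R ^ 2 ≤ κ * η := by
    rw [hRdef, ← Real.rpow_natCast, ← Real.rpow_mul (by positivity), hκdef, hηdef,
      ← Real.mul_rpow (by positivity) (by positivity),
      show 1 / (d : ℝ) * ((2 : ℕ) : ℝ) = 2 / d by push_cast; ring]
    refine Real.rpow_le_rpow (by positivity) ?_ (by positivity)
    rw [one_div_mul_eq_div]
    exact div_le_div_of_nonneg_left ha.le (by positivity)
      (mul_le_mul_of_nonneg_left (hpb x).1 hm.le)
  have hRr : ∀ z, 0 < z → z ≤ 2 → R * z < r₀ := by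
    intro z hz hz2
    have h1 := hη
    rw [lt_div_iff₀ (by positivity)] at h1
    refine lt_of_pow_lt_pow_left₀ 2 hr₀.le ?_
    have : z ^ 2 ≤ 4 := by nlinarith
    rw [mul_pow]
    nlinarith [sq_nonneg R]
  obtain ⟨hup, hlow⟩ := ball_mass_bounds hd hR hm hpmin (hpb x).1 hK hη0 hκ hε0 hRd hR2 rfl hE
    hdE.le
  have hq1 := hup _ (hexp x (R + R * E) (by positivity)
    (by rw [show R + R * E = R * (1 + E) by ring]; exact hRr _ (by linarith) (by linarith)))
  have hq2 := hlow _ (hexp x (R - R * E)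
    (by rw [show R - R * E = R * (1 - E) by ring]; exact mul_pos hR (by linarith))
    (by rw [show R - R * E = R * (1 - E) by ring]; exact hRr _ (by linarith) (by linarith)))
  have hNa : N * a = k N := by rw [hadef]; field_simp
  have hconc := le_measureReal_pi_abs_knnRadius_sub_le (samplingMeasure g p) ι
    hι.contMDiff.continuous.measurable x N (k N) (R := R) (δ := R * E) hε0 hε1 (by positivity)
    (by rw [← hNa, mul_assoc]; exact mul_le_mul_of_nonneg_left hq1 hNpos.le)
    (by rw [← hNa, mul_assoc]; exact mul_le_mul_of_nonneg_left hq2 hNpos.le)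
  have htail : Real.exp (-(k N * ε ^ 2 / 6)) < (N : ℝ) ^ (-s) :=
    exp_neg_mul_sq_lt_rpow_neg (by exact_mod_cast (by omega : 1 < N)) hkpos hs
  refine lt_of_lt_of_le (by linarith) (hconc.trans (measureReal_mono fun Y hY => ?_))
  set b := (1 / m * a) ^ (-1 / (d : ℝ)) with hbdef
  have hb : 0 < b := by positivity
  have h4 : rhoBar d p x = R * b := rpow_neg_one_div_eq_mul hpx ha hm
  have h5 : rhoHat d ι (k N) Y x = knnRadius ι (k N) Y x * b := by
    rw [rhoHat, m0_knnKernel]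
  change |rhoHat d ι (k N) Y x - rhoBar d p x| / rhoBar d p x ≤ E
  rw [h4, h5, ← sub_mul, abs_mul, abs_of_pos hb, div_le_iff₀ (by positivity)]
  calc |knnRadius ι (k N) Y x - R| * b ≤ R * E * b := mul_le_mul_of_nonneg_right hY hb.le
    _ = E * (R * b) := by ring
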